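/- Fix an integer $q\ge 2$. A planar map is a connected graph (multiple edges allowed) embedded without edge crossings in the oriented sphere, considered up to orientation-preserving homeomorphisms. It is bicolored if its vertices are colored black and white so that every edge joins a black and a white vertex (isomorphisms preserve the colors), and $2q$-regular if all its vertices have valency $2q$. A Hamiltonian cycle on such a map is a closed self-avoiding path along the edges that visits all the vertices; it is rigid if at each vertex exactly $q-1$ of the unvisited edges lie on each side of the cycle. For $N\ge 1$ let $z_N$ be the number of $2q$-regular bicolored planar maps with $2N$ vertices equipped with a rigid Hamiltonian cycle and with a marked visited edge (up to isomorphism). For $N\ge 0$ let $c_N$ be the number of arch systems: on a line carrying $2N$ vertices, alternately black and white from left to right and starting with a black one, the configurations of non-crossing arches drawn on one fixed side of the line such that each arch joins a black and a white vertex and each vertex is incident to exactly $q-1$ arches. Then $z_N=c_N^2$ for all $N\ge 1$. Moreover $c_0=1$, $$c_N=\sum_{\substack{m_1,\dots,m_q\ge 0\\ m_1+\cdots+m_q=N-1}}\ \prod_{j=1}^{q}c_{m_j}\qquad (N\ge 1),$$ that is, the generating function $c(x)=\sum_{N\ge 0}c_N x^N$ satisfies $c(x)=1+x\,c(x)^q$,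 and $c_N$ is the Fuss–Catalan number $$c_N=\frac{1}{(q-1)N+1}\binom{qN}{N}\qquad (N\ge 0).$$ Consequently $$z_N=\left(\frac{1}{(q-1)N+1}\binom{qN}{N}\right)^2\ (N\ge 1),\qquad z_N\underset{N\to\infty}{\sim}\frac{q}{2\pi(q-1)^3}\,\frac{\left(\frac{q^q}{(q-1)^{q-1}}\right)^{2N}}{N^3}.$$ In particular $z_N\sim\varkappa\,\mu^{2N}/N^{2-\gamma}$ holds, with real $\varkappa,\mu>0$ and real $\gamma$, if and only if $\varkappa=\frac{q}{2\pi(q-1)^3}$, $\mu=\frac{q^q}{(q-1)^{q-1}}$ and $\gamma=-1$; so the configuration exponent $\gamma$ is exactly $-1$. -/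

import Mathlib

open Filter Asymptotics

/-! ### Planar maps -/

/-- A map on an oriented surface, encoded by its set `D` of half-edges (darts). -/
structure CombMap (D : Type) where
  /-- the next dart counterclockwise around the same vertex -/
  rot : Equiv.Perm D
  /-- the other dart of the same edge -/
  opp : Equiv.Perm D
  opp_opp : ∀ d, opp (opp d) = d
  opp_ne : ∀ d, opp d ≠ d

namespace CombMap

variable {D : Type}

/-- The vertices are the cycles of `rot`. -/
abbrev Vertex (M : CombMap D) : Type := Quotient (Equiv.Perm.SameCycle.setoid M.rot)

/-- The edges are the cycles of `opp`. -/
abbrev Edge (M : CombMap D) : Type := Quotient (Equiv.Perm.SameCycle.setoid M.opp)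

/-- The faces are the cycles of `rot * opp`. -/
abbrev Face (M : CombMap D) : Type := Quotient (Equiv.Perm.SameCycle.setoid (M.rot * M.opp))

/-- The vertex at which a dart starts. -/
def vertexOf (M : CombMap D) (d : D) : M.Vertex := Quotient.mk _ d

/-- The underlying graph is connected. -/
def Connected (M : CombMap D) : Prop :=
  ∀ d e : D, ∃ g ∈ Subgroup.closure ({M.rot, M.opp} : Set (Equiv.Perm D)), g d = e

/-- The surface is the sphere: the map is connected, and `V - E + F = 2`. -/
def Planar (M : CombMap D) : Prop :=
  M.Connected ∧ Nat.card M.Vertex + Nat.card M.Face = Nat.card M.Edge + 2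

/-- Every vertex has valency `p`. -/
def Regular (M : CombMap D) (p : ℕ) : Prop :=
  ∀ d : D, Set.ncard {e : D | M.vertexOf e = M.vertexOf d} = p

/-- `black d` says that the vertex at which `d` starts is black (it is white otherwise);
every edge joins a black vertex and a white vertex. -/
def IsBicoloring (M : CombMap D) (black : D → Bool) : Prop :=
  (∀ d, black (M.rot d) = black d) ∧ (∀ d, black (M.opp d) = !(black d))

/-- `H` is the set of darts of the edges of a Hamiltonian cycle: there is a closed path, whose
`i`-th step is along the edge of the dart `p i`, which visits every vertex exactly once and does
not use an edge twice, and `H` consists of the darts of the edges that it uses. -/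
def IsHamiltonianCycle (M : CombMap D) (H : Set D) : Prop :=
  ∃ n : ℕ, 0 < n ∧ ∃ p : ZMod n → D,
    Function.Bijective (fun i => M.vertexOf (p i)) ∧
    (∀ i, M.vertexOf (M.opp (p i)) = M.vertexOf (p (i + 1))) ∧
    (∀ i j, p i ≠ M.opp (p j)) ∧
    H = {d | ∃ i, d = p i ∨ d = M.opp (p i)}

/-- Turning counterclockwise around a vertex from a visited dart, one meets exactly `q - 1`
unvisited darts before the next visited one. -/
def IsRigid (M : CombMap D) (q : ℕ) (H : Set D) : Prop :=
  ∀ d ∈ H, (∀ k, 0 < k → k < q → (M.rot ^ k) d ∉ H) ∧ (M.rot ^ q) d ∈ H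

end CombMap

/-- A `2q`-regular bicolored planar map with `2N` vertices, equipped with a rigid Hamiltonian
cycle and with a marked visited edge. -/
structure RigidConfig (q N : ℕ) (D : Type) where
  map : CombMap D
  planar : map.Planar
  regular : map.Regular (2 * q)
  card_vertex : Nat.card map.Vertex = 2 * N
  black : D → Bool
  bicolored : map.IsBicoloring black
  /-- the darts of the edges of the Hamiltonian cycle -/
  visited : Set D
  hamiltonian : map.IsHamiltonianCycle visited
  rigid : map.IsRigid q visited
  /-- the marked visited edge, given by that one of its two darts which starts at its black end -/
  marked : D
  marked_visited : marked ∈ visited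
  marked_black : black marked = true

/-- Two configurations are the same up to an orientation-preserving homeomorphism of the sphere
respecting the map, the colors, the cycle and the marked edge. -/
def RigidConfig.Iso {q N : ℕ} {D E : Type} (A : RigidConfig q N D) (B : RigidConfig q N E) :
    Prop :=
  ∃ e : D ≃ E,
    (∀ d, e (A.map.rot d) = B.map.rot (e d)) ∧
    (∀ d, e (A.map.opp d) = B.map.opp (e d)) ∧
    (∀ d, B.black (e d) = A.black d) ∧
    (∀ d, e d ∈ B.visited ↔ d ∈ A.visited) ∧
    e A.marked = B.marked

/-- Configurations on finite sets of darts, up to isomorphism. -/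
def rigidSetoid (q N : ℕ) : Setoid (Σ n : ℕ, RigidConfig q N (Fin n)) where
  r A B := A.2.Iso B.2
  iseqv := by
    refine ⟨fun A => ⟨Equiv.refl _, by simp⟩, ?_, ?_⟩
    · rintro A B ⟨e, h1, h2, h3, h4, h5⟩
      refine ⟨e.symm, fun d => ?_, fun d => ?_, fun d => ?_, fun d => ?_, ?_⟩
      · rw [Equiv.symm_apply_eq, h1, Equiv.apply_symm_apply]
      · rw [Equiv.symm_apply_eq, h2, Equiv.apply_symm_apply]
      · rw [← h3, Equiv.apply_symm_apply]
      · rw [← h4, Equiv.apply_symm_apply]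
      · rw [Equiv.symm_apply_eq, h5]
    · rintro A B C ⟨e, h1, h2, h3, h4, h5⟩ ⟨f, g1, g2, g3, g4, g5⟩
      refine ⟨e.trans f, fun d => ?_, fun d => ?_, fun d => ?_, fun d => ?_, ?_⟩
      · simp [h1, g1]
      · simp [h2, g2]
      · simp [h3, g3]
      · simp [h4, g4]
      · simp [h5, g5]

/-- The partition function `z_N`: the number of rigid Hamiltonian cycles, with a marked visited
edge, on `2q`-regular bicolored planar maps with `2N` vertices. -/
noncomputable def rigidCount (q N : ℕ) : ℕ :=
  Nat.card (Quotient (rigidSetoid q N))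

/-! ### Arch systems -/

/-- The half-arches on one side of the line: the vertices `0, …, 2N - 1` from left to right, each
with `q - 1` half-arches, also ordered from left to right. -/
abbrev HalfArch (q N : ℕ) : Type := Fin (2 * N) ×ₗ Fin (q - 1)

/-- The vertices on the line are alternately black and white, beginning with a black one. -/
def HalfArch.black {q N : ℕ} (x : HalfArch q N) : Prop := Even ((ofLex x).1 : ℕ)

/-- `f` pairs the half-arches into non-crossing arches that connect black and white vertices. -/
def IsArchSystem {q N : ℕ} (f : HalfArch q N → HalfArch q N) : Prop :=
  (∀ x, f (f x) = x) ∧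
  (∀ x, (f x).black ↔ ¬ x.black) ∧
  (∀ x y, ¬ (x < y ∧ y < f x ∧ f x < f y))

/-- The number `c_N` of arch systems on one side of the line. -/
noncomputable def archCount (q N : ℕ) : ℕ :=
  Nat.card {f : HalfArch q N → HalfArch q N // IsArchSystem f}

/-! ### Asymptotics -/

/-- `z_N ~ ϰ μ ^ (2N) / N ^ (2 - γ)`; the number `γ` is the configuration exponent. -/
def HasConfigurationAsymptotics (z : ℕ → ℕ) (ϰ μ γ : ℝ) : Prop :=
  0 < ϰ ∧ 0 < μ ∧
    (fun N : ℕ => (z N : ℝ)) ~[atTop] fun N : ℕ => ϰ * μ ^ (2 * N) / (N : ℝ) ^ (2 - γ)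

/-!
# Rigid Hamiltonian cycles on bicolored planar maps and Fuss-Catalan numbers
-/

/-! ### Fuss-Catalan numbers -/

/-! The proof has two independent halves: a bijection and a count.

For the bijection, the marked dart orients the cycle. The vertices are numbered along it, and the
darts at each vertex counterclockwise from the outgoing one. Rigidity makes the incoming dart number
`q`, so `rot` and the cycle part of `opp` have a standard form (`RigidConfig.exists_frame`). What
remains is the pairing of the unvisited darts, an involution `τ`. Faces are cycles of `rot * opp = ρ
* τ`, where `ρ` uses only the edges of the cycle. The two cycles of `ρ` are the two sides of the
Hamiltonian cycle (`IsFrame.isTwoCycles`). Each transposition of `τ` adds at most one cycle, and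
Euler's formula says exactly that each one adds one. This maximum is attained precisely when no arch
changes sides and no two arches on the same side cross (`numCycles_mul_involution_eq_iff`). As the
colors are forced to alternate, a configuration amounts to an arbitrary pair of arch systems, whence
`rigidCount_eq`.

For the count, an arch system is a non-crossing bicolored matching of alternating blocks of length
`k = q - 1`. The number of matchings is invariant under rotation of the word
(`matchingCount_rotate`), so any interval of `t` full periods is counted by the same number.
Removing the first point of an interval with `i + 1` black points, then whole periods, then `i + 1`
further points, the partner is located by color balance, and a factor `C` of the generating function
splits off (`mk_matchingCount_block`). After `k` points this gives `C = 1 + X C ^ (k + 1)`. The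
coefficients of the powers of `C` satisfy the Raney recursion, which yields the Fuss-Catalan numbers
(`coeff_eq_fussCatalan`).

Stirling's formula then gives the asymptotics, and comparing logarithms shows that the three
constants are unique. -/

/-- The Raney recursion determines its solution. -/
theorem raney_unique (q : ℕ) (a b : ℕ → ℕ → ℝ)
    (h0 : ∀ r, a r 0 = b r 0) (h1 : ∀ n, a 0 (n + 1) = b 0 (n + 1))
    (ha : ∀ r n, a (r + 1) (n + 1) = a r (n + 1) + a (r + q) n)
    (hb : ∀ r n, b (r + 1) (n + 1) = b r (n + 1) + b (r + q) n) (n r : ℕ) : a r n = b r n := by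
  induction n generalizing r with
  | zero => exact h0 r
  | succ n ih =>
    induction r with
    | zero => exact h1 n
    | succ r ihr => rw [ha, hb, ihr, ih]

/-- The Raney numbers `r / (q n + r) * C(q n + r, n)`. -/
noncomputable def raney (q r n : ℕ) : ℝ :=
  -- The formula reads `0 / 0` in this case, while the constant coefficient of `C ^ 0` is `1`.
  if r = 0 ∧ n = 0 then 1 else (r : ℝ) / (q * n + r) * ((q * n + r).choose n : ℝ)

/-- With `m = q n + r + q` the three binomials are `C(m + 1, n + 1)`, `C(m, n + 1)` and `C(m, n)`.
Pascal's rule and the ratio of neighbouring binomials reduce the claim to an identity of rational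
functions. -/
theorem raney_succ (q : ℕ) (hq : 1 ≤ q) (r n : ℕ) :
    raney q (r + 1) (n + 1) = raney q r (n + 1) + raney q (r + q) n := by
  obtain ⟨p, rfl⟩ : ∃ p, q = p + 1 := ⟨q - 1, by omega⟩
  have e1 : (p + 1) * (n + 1) + (r + 1) = ((p + 1) * n + r + p + 1) + 1 := by ring
  have e2 : (p + 1) * (n + 1) + r = (p + 1) * n + r + p + 1 := by ring
  have e3 : (p + 1) * n + (r + (p + 1)) = (p + 1) * n + r + p + 1 := by ring
  have hpos : (0 : ℝ) < ((p + 1) * n + r + p + 1 : ℝ) := by positivity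
  unfold raney
  rw [if_neg (by omega), if_neg (by omega), if_neg (by omega), e1, e2, e3]
  set m := (p + 1) * n + r + p + 1 with hm
  have hmR : (m : ℝ) = (p + 1) * n + r + p + 1 := by simp [hm]
  have hmp : (0 : ℝ) < m := by rw [hmR]; exact hpos
  have hpas : ((m + 1).choose (n + 1) : ℝ) = m.choose n + m.choose (n + 1) := by
    exact_mod_cast Nat.choose_succ_succ m n
  have hnm : n ≤ m := by
    have : n ≤ (p + 1) * n := Nat.le_mul_of_pos_left n (by omega)
    omega
  have hrel : (m.choose (n + 1) : ℝ) * (n + 1) = m.choose n * (m - n) := by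
    have := Nat.choose_succ_right_eq m n
    rw [← Nat.cast_sub hnm]
    exact_mod_cast this
  have d1 : ((p + 1 : ℕ) : ℝ) * ((n + 1 : ℕ) : ℝ) + ((r + 1 : ℕ) : ℝ) = m + 1 := by
    rw [hmR]; push_cast; ring
  have d2 : ((p + 1 : ℕ) : ℝ) * ((n + 1 : ℕ) : ℝ) + (r : ℝ) = m := by
    rw [hmR]; push_cast; ring
  have d3 : ((p + 1 : ℕ) : ℝ) * (n : ℝ) + ((r + (p + 1) : ℕ) : ℝ) = m := by
    rw [hmR]; push_cast; ring
  rw [d1, d2, d3, hpas]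
  have hY : (m.choose (n + 1) : ℝ) = m.choose n * (m - n) / (n + 1) := by
    field_simp; linarith
  rw [hY]
  have hn : (0 : ℝ) < n + 1 := by positivity
  have : (m : ℝ) + 1 ≠ 0 := by positivity
  push_cast
  field_simp
  rw [hmR]
  ring

/-- A power series with `C = 1 + X C ^ q` has the Fuss-Catalan numbers as coefficients. -/
theorem coeff_eq_fussCatalan (q : ℕ) (hq : 1 ≤ q) (C : PowerSeries ℝ)
    (hC : C = 1 + PowerSeries.X * C ^ q) (n : ℕ) :
    PowerSeries.coeff n C = 1 / (((q : ℝ) - 1) * n + 1) * ((q * n).choose n : ℝ) := by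
  have hc0 : PowerSeries.constantCoeff C = 1 := by
    rw [hC]; simp
  have key := raney_unique q (fun r n => PowerSeries.coeff n (C ^ r)) (raney q)
    (fun r => by
      by_cases hr : r = 0
      · simp [hr, raney]
      · have : (r : ℝ) ≠ 0 := by exact_mod_cast hr
        simp [raney, hc0, hr])
    (fun n => by simp [raney, PowerSeries.coeff_one])
    (fun r n => by
      -- The functional equation multiplied by `C ^ r` is the Raney recursion for the coefficients
      -- of the powers.
      have : C ^ (r + 1) = C ^ r + PowerSeries.X * C ^ (r + q) := by
        calc C ^ (r + 1) = C ^ r * C := pow_succ _ _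
          _ = C ^ r * (1 + PowerSeries.X * C ^ q) := by rw [← hC]
          _ = _ := by ring
      simp only [this, map_add, PowerSeries.coeff_succ_X_mul])
    (fun r n => raney_succ q hq r n) n 1
  simp only [pow_one] at key
  rw [key, raney, if_neg (by omega)]
  have hle : n ≤ q * n := Nat.le_mul_of_pos_left n (by omega)
  -- Converts the Raney number for `r = 1`, which has `C(q n + 1, n)`, to the form with `C(q n, n)`.
  have h2 : ((q * n + 1).choose n : ℝ) * (((q : ℝ) - 1) * n + 1) =
      (q * n + 1) * (q * n).choose n := by
    have h4 := Nat.choose_mul_succ_eq (q * n) n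
    have h5 : ((q * n + 1 - n : ℕ) : ℝ) = ((q : ℝ) - 1) * n + 1 := by
      rw [Nat.cast_sub (by omega)]; push_cast; ring
    rw [← h5]
    have : ((q * n).choose n : ℝ) * ((q * n : ℕ) + 1) = (q * n + 1).choose n * (q * n + 1 - n : ℕ) := by
      exact_mod_cast h4
    rw [← this]; push_cast; ring
  have hq1 : (0 : ℝ) ≤ (q : ℝ) - 1 := by
    have : (1 : ℝ) ≤ q := by exact_mod_cast hq
    linarith
  have p1 : (0 : ℝ) < ((q : ℝ) - 1) * n + 1 := by positivity
  have p2 : (0 : ℝ) < (q : ℝ) * n + 1 := by positivity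
  push_cast
  field_simp
  linarith

/-- The coefficients of a power, as sums over tuples. -/
theorem coeff_pow_eq_sum_antidiagonalTuple (c : ℕ → ℕ) (q n : ℕ) :
    PowerSeries.coeff n (PowerSeries.mk c ^ q) =
      ∑ m ∈ Finset.Nat.antidiagonalTuple q n, ∏ j, c (m j) := by
  have h : PowerSeries.mk c ^ q = ∏ _j : Fin q, PowerSeries.mk c := by simp
  rw [h, PowerSeries.coeff_prod]
  refine Finset.sum_bij (fun l _ => ⇑l) ?_ ?_ ?_ ?_
  · intro l hl
    rw [Finset.Nat.mem_antidiagonalTuple]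
    exact (Finset.mem_finsuppAntidiag.1 hl).1
  · intro l _ l' _ h
    exact DFunLike.coe_injective h
  · intro m hm
    refine ⟨Finsupp.equivFunOnFinite.symm m, ?_, by ext; simp⟩
    rw [Finset.mem_finsuppAntidiag]
    exact ⟨by simpa using Finset.Nat.mem_antidiagonalTuple.1 hm, by simp⟩
  · intro l _
    simp

/-! ### Asymptotics of the squares of the Fuss-Catalan numbers -/

/-- Stirling's formula is applied to `(q N)!`, `N!` and `((q - 1) N)!`. Squaring removes the square
roots, so the powers of `N` and of `e` cancel by plain algebra. -/
theorem fussCatalan_sq_isEquivalent (q : ℕ) (hq : 2 ≤ q) :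
    (fun N : ℕ => (1 / (((q : ℝ) - 1) * N + 1) * ((q * N).choose N : ℝ)) ^ 2) ~[atTop]
      fun N : ℕ => (q : ℝ) / (2 * Real.pi * ((q : ℝ) - 1) ^ 3) *
        ((q : ℝ) ^ q / ((q : ℝ) - 1) ^ (q - 1)) ^ (2 * N) / (N : ℝ) ^ 3 := by
  obtain ⟨p, rfl⟩ : ∃ p, q = p + 1 := ⟨q - 1, by omega⟩
  have hp : 1 ≤ p := by omega
  have hp0 : (0 : ℝ) < p := by exact_mod_cast hp
  have hsub : ((p + 1 : ℕ) : ℝ) - 1 = p := by push_cast; ring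
  simp only [hsub, Nat.add_sub_cancel]
  set S : ℕ → ℝ := fun n => Real.sqrt (2 * n * Real.pi) * (n / Real.exp 1) ^ n with hS
  have hSt : (fun n : ℕ => (n.factorial : ℝ)) ~[atTop] S :=
    Stirling.factorial_isEquivalent_stirling
  have ht (a : ℕ) (ha : 1 ≤ a) : Tendsto (fun N : ℕ => a * N) atTop atTop :=
    tendsto_id.const_mul_atTop' (by omega)
  have h1 := hSt.comp_tendsto (ht (p + 1) (by omega))
  have h2 := hSt.comp_tendsto (ht p hp)
  have hlin : (fun N : ℕ => (p : ℝ) * N + 1) ~[atTop] fun N : ℕ => (p : ℝ) * N := by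
    refine IsEquivalent.add_isLittleO IsEquivalent.refl ?_
    rw [isLittleO_const_left]
    right
    refine tendsto_norm_atTop_atTop.comp ?_
    exact tendsto_natCast_atTop_atTop.const_mul_atTop hp0
  have hE := (h1.div ((hlin.mul (hSt.mul h2)))).pow 2
  refine (hE.congr_left ?_).congr_right ?_
  · refine Eventually.of_forall fun N => ?_
    have hch : (((p + 1) * N).choose N : ℝ) =
        ((p + 1) * N).factorial / (N.factorial * (p * N).factorial) := by
      have hle : N ≤ (p + 1) * N := Nat.le_mul_of_pos_left N (by omega)
      rw [Nat.cast_choose ℝ hle]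
      congr 4
      rw [Nat.add_mul, Nat.one_mul, Nat.add_sub_cancel]
    simp only [Pi.pow_apply, Pi.div_apply, Pi.mul_apply, Function.comp, hch]
    field_simp
  · filter_upwards [eventually_ge_atTop 1] with N hN
    have hN0 : (0 : ℝ) < N := by exact_mod_cast hN
    have hpi := Real.pi_pos
    have hSS (n : ℕ) : S n ^ 2 = 2 * n * Real.pi * (n / Real.exp 1) ^ (2 * n) := by
      simp only [hS, mul_pow]
      rw [Real.sq_sqrt (by positivity), ← pow_mul, mul_comm n 2]
    simp only [Pi.pow_apply, Pi.div_apply, Pi.mul_apply, Function.comp, div_pow, mul_pow, hSS]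
    push_cast
    have he : Real.exp 1 ≠ 0 := (Real.exp_pos 1).ne'
    have x1 : (((p : ℝ) + 1) * N) ^ (2 * ((p + 1) * N)) =
        (((p : ℝ) + 1) ^ (p + 1)) ^ (2 * N) * ((N : ℝ) ^ (2 * N) * (N : ℝ) ^ (2 * (p * N))) := by
      rw [mul_pow, ← pow_mul, ← pow_add]
      congr 2 <;> ring
    have x2 : ((p : ℝ) * N) ^ (2 * (p * N)) =
        ((p : ℝ) ^ p) ^ (2 * N) * (N : ℝ) ^ (2 * (p * N)) := by
      rw [mul_pow, ← pow_mul]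
      congr 2; ring
    have x3 : (Real.exp 1) ^ (2 * ((p + 1) * N)) =
        (Real.exp 1) ^ (2 * N) * (Real.exp 1) ^ (2 * (p * N)) := by
      rw [← pow_add]; congr 1; ring
    rw [x1, x2, x3]
    have y1 := pow_pos hN0 (2 * N)
    have y2 := pow_pos hN0 (2 * (p * N))
    have y3 := pow_pos (pow_pos hp0 p) (2 * N)
    have y4 := pow_pos (Real.exp_pos 1) (2 * N)
    have y5 := pow_pos (Real.exp_pos 1) (2 * (p * N))
    generalize (N : ℝ) ^ (2 * N) = a1 at *
    generalize (N : ℝ) ^ (2 * (p * N)) = a2 at *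
    generalize ((p : ℝ) ^ p) ^ (2 * N) = a3 at *
    generalize (Real.exp 1) ^ (2 * N) = a4 at *
    generalize (Real.exp 1) ^ (2 * (p * N)) = a5 at *
    generalize (((p : ℝ) + 1) ^ (p + 1)) ^ (2 * N) = a6 at *
    field_simp

/-- The constants in an asymptotic law `A μ ^ (2 N) / N ^ s` are determined by it. -/
theorem asymptotic_constants_unique {A B μ ν s t : ℝ} (hA : 0 < A) (hB : 0 < B) (hμ : 0 < μ)
    (hν : 0 < ν)
    (h : (fun N : ℕ => A * μ ^ (2 * N) / (N : ℝ) ^ s) ~[atTop]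
      fun N : ℕ => B * ν ^ (2 * N) / (N : ℝ) ^ t) : A = B ∧ μ = ν ∧ s = t := by
  have hpos : ∀ᶠ N : ℕ in atTop, (0 : ℝ) < N :=
    (eventually_gt_atTop 0).mono fun N hN => by exact_mod_cast hN
  have h1 := (isEquivalent_iff_tendsto_one (hpos.mono fun N hN => by positivity)).1 h
  have h2 := (Real.continuousAt_log one_ne_zero).tendsto.comp h1
  rw [Real.log_one] at h2
  -- The logarithm of the ratio is a combination of `1`, `log N` and `N` that tends to zero.
  -- Dividing by `N`, then by `log N`, kills the coefficients in turn.
  have h3 : Tendsto (fun N : ℕ => Real.log A - Real.log B + 2 * (Real.log μ - Real.log ν) * N -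
      (s - t) * Real.log N) atTop (nhds 0) := by
    refine h2.congr' (hpos.mono fun N hN => ?_)
    have e1 : (N : ℝ) ^ s ≠ 0 := by positivity
    have e2 : (N : ℝ) ^ t ≠ 0 := by positivity
    simp only [Function.comp, Pi.div_apply]
    rw [Real.log_div (by positivity) (by positivity), Real.log_div (by positivity) e1,
      Real.log_div (by positivity) e2, Real.log_mul (by positivity) (by positivity),
      Real.log_mul (by positivity) (by positivity), Real.log_pow, Real.log_pow,
      Real.log_rpow hN, Real.log_rpow hN]
    push_cast
    ring
  have hNtop : Tendsto (fun N : ℕ => (N : ℝ)) atTop atTop := tendsto_natCast_atTop_atTop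
  have hlogtop := Real.tendsto_log_atTop.comp hNtop
  have hinv := tendsto_inv_atTop_zero.comp hNtop
  have hloginv := tendsto_inv_atTop_zero.comp hlogtop
  have hlogdiv : Tendsto (fun N : ℕ => Real.log N / N) atTop (nhds 0) := by
    have := (Real.isLittleO_log_id_atTop.tendsto_div_nhds_zero).comp hNtop
    exact this
  have hμν : μ = ν := by
    have h4 : Tendsto (fun N : ℕ => (Real.log A - Real.log B + 2 * (Real.log μ - Real.log ν) * N -
        (s - t) * Real.log N) * (N : ℝ)⁻¹ - (Real.log A - Real.log B) * (N : ℝ)⁻¹ +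
        (s - t) * (Real.log N / N)) atTop
        (nhds (0 * 0 - (Real.log A - Real.log B) * 0 + (s - t) * 0)) :=
      ((h3.mul hinv).sub (hinv.const_mul _)).add (hlogdiv.const_mul _)
    have h5 : Tendsto (fun _ : ℕ => 2 * (Real.log μ - Real.log ν)) atTop (nhds 0) := by
      simp only [mul_zero, sub_zero, add_zero] at h4
      refine h4.congr' (hpos.mono fun N hN => ?_)
      field_simp
      ring
    have h6 := tendsto_nhds_unique h5 tendsto_const_nhds
    exact Real.log_injOn_pos hμ hν (by linarith)
  subst hμν
  simp only [sub_self, mul_zero, zero_mul, add_zero] at h3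
  have hst : s = t := by
    have h4 : Tendsto (fun N : ℕ => (Real.log A - Real.log B - (s - t) * Real.log N) *
        (Real.log N)⁻¹ - (Real.log A - Real.log B) * (Real.log N)⁻¹) atTop
        (nhds (0 * 0 - (Real.log A - Real.log B) * 0)) :=
      (h3.mul hloginv).sub (hloginv.const_mul _)
    have h5 : Tendsto (fun _ : ℕ => -(s - t)) atTop (nhds 0) := by
      simp only [mul_zero, sub_zero] at h4
      refine h4.congr' ((hlogtop.eventually_gt_atTop 0).mono fun N hN => ?_)
      simp only [Function.comp] at hN
      field_simp
      ring
    have h6 := tendsto_nhds_unique h5 tendsto_const_nhds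
    linarith
  subst hst
  simp only [sub_self, zero_mul, sub_zero] at h3
  have h6 := tendsto_nhds_unique h3 tendsto_const_nhds
  exact ⟨Real.log_injOn_pos hA hB (by linarith), rfl, rfl⟩

/-- If `z_N ~ A μ ^ (2 N) / N ^ 3`, then the configuration exponent is `-1`, and the constants
are determined. -/
theorem hasConfigurationAsymptotics_iff {z : ℕ → ℕ} {A μ : ℝ} (hA : 0 < A) (hμ : 0 < μ)
    (hz : (fun N : ℕ => (z N : ℝ)) ~[atTop] fun N : ℕ => A * μ ^ (2 * N) / (N : ℝ) ^ 3)
    (ϰ ν γ : ℝ) : HasConfigurationAsymptotics z ϰ ν γ ↔ ϰ = A ∧ ν = μ ∧ γ = -1 := by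
  have h3 : (fun N : ℕ => A * μ ^ (2 * N) / (N : ℝ) ^ 3) =
      fun N : ℕ => A * μ ^ (2 * N) / (N : ℝ) ^ (3 : ℝ) := by
    funext N
    rw [show (3 : ℝ) = ((3 : ℕ) : ℝ) by norm_num, Real.rpow_natCast]
  rw [h3] at hz
  constructor
  · rintro ⟨h1, h2, h⟩
    obtain ⟨e1, e2, e3⟩ := asymptotic_constants_unique h1 hA h2 hμ (h.symm.trans hz)
    exact ⟨e1, e2, by linarith⟩
  · rintro ⟨rfl, rfl, rfl⟩
    refine ⟨hA, hμ, ?_⟩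
    rw [show (2 : ℝ) - -1 = 3 by norm_num]
    exact hz

/-! ### Non-crossing bicolored matchings of an interval -/

/-- `f` is a non-crossing perfect matching of the interval `[a, b)`, extended by the identity, all
of whose arches join points of different colors. -/
structure IsMatching (col : ℕ → Bool) (a b : ℕ) (f : ℕ → ℕ) : Prop where
  invol : ∀ x, f (f x) = x
  outside : ∀ x, x < a ∨ b ≤ x → f x = x
  color : ∀ x, a ≤ x → x < b → col (f x) ≠ col x
  noncrossing : ∀ x y, ¬ (x < y ∧ y < f x ∧ f x < f y)

/-- The number of non-crossing bicolored matchings of the interval `[a, b)`. -/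
noncomputable def matchingCount (col : ℕ → Bool) (a b : ℕ) : ℕ :=
  Nat.card {f : ℕ → ℕ // IsMatching col a b f}

theorem IsMatching.maps {col : ℕ → Bool} {a b : ℕ} {f : ℕ → ℕ} (hf : IsMatching col a b f) {x : ℕ}
    (h1 : a ≤ x) (h2 : x < b) : a ≤ f x ∧ f x < b := by
  by_contra h
  have h3 := hf.outside (f x) (by omega)
  rw [hf.invol] at h3
  exact hf.color x h1 h2 (by rw [← h3])

theorem IsMatching.ne {col : ℕ → Bool} {a b : ℕ} {f : ℕ → ℕ} (hf : IsMatching col a b f) {x : ℕ}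
    (h1 : a ≤ x) (h2 : x < b) : f x ≠ x := fun h => hf.color x h1 h2 (by rw [h])

instance finite_isMatching (col : ℕ → Bool) (a b : ℕ) :
    Finite {f : ℕ → ℕ // IsMatching col a b f} := by
  have hlt (f : {f : ℕ → ℕ // IsMatching col a b f}) (x : Fin b) : f.1 x < b := by
    by_cases h : a ≤ x
    · exact (f.2.maps h x.2).2
    · rw [f.2.outside x (by omega)]; exact x.2
  refine Finite.of_injective (β := Fin b → Fin b) (fun f x => ⟨f.1 x, hlt f x⟩) ?_
  intro f g h
  ext x
  by_cases hx : x < b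
  · exact congrArg Fin.val (congrFun h ⟨x, hx⟩)
  · rw [f.2.outside x (by omega), g.2.outside x (by omega)]

theorem matchingCount_self (col : ℕ → Bool) (a : ℕ) : matchingCount col a a = 1 := by
  rw [matchingCount, Nat.card_eq_one_iff_unique]
  refine ⟨⟨fun f g => ?_⟩, ⟨id, fun _ => rfl, fun _ _ => rfl, fun x h1 h2 => by omega,
    fun x y => by simp only [id]; omega⟩⟩
  ext x
  rw [f.2.outside x (by omega), g.2.outside x (by omega)]

/-- The matching in which `a` is joined to `c`, which is `f` below this arch and `g` after it. -/
def glueMatching (a c : ℕ) (f g : ℕ → ℕ) (x : ℕ) : ℕ :=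
  if x = a then c else if x = c then a else if x < c then f x else g x

theorem isMatching_glue {col : ℕ → Bool} {a b c : ℕ} {f g : ℕ → ℕ} (hac : a < c) (hcb : c < b)
    (hcol : col c ≠ col a) (hf : IsMatching col (a + 1) c f) (hg : IsMatching col (c + 1) b g) :
    IsMatching col a b (glueMatching a c f g) := by
  have f1 : ∀ x, a < x → x < c → a < f x ∧ f x < c := fun x h1 h2 => by
    have := hf.maps (x := x) (by omega) h2; omega
  have g1 : ∀ x, c < x → x < b → c < g x ∧ g x < b := fun x h1 h2 => by
    have := hg.maps (x := x) (by omega) h2; omega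
  have f0 : ∀ x, x ≤ a ∨ c ≤ x → f x = x := fun x h => hf.outside x (by omega)
  have g0 : ∀ x, x ≤ c ∨ b ≤ x → g x = x := fun x h => hg.outside x (by omega)
  have fi := hf.invol
  have gi := hg.invol
  have e1 : glueMatching a c f g a = c := by simp [glueMatching]
  have e2 : glueMatching a c f g c = a := by simp [glueMatching, hac.ne']
  have e3 : ∀ x, x ≠ a → x < c → glueMatching a c f g x = f x := fun x h1 h2 => by
    simp [glueMatching, h1, h2, h2.ne]
  have e4 : ∀ x, c < x → glueMatching a c f g x = g x := fun x h => by
    have h1 : x ≠ a := by omega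
    have h2 : ¬ x < c := by omega
    simp [glueMatching, h1, h2, h.ne']
  refine ⟨fun x => ?_, fun x hx => ?_, fun x h1 h2 => ?_, fun x y => ?_⟩
  · grind
  · grind
  · have := hf.color x
    have := hg.color x
    grind
  · have := hf.noncrossing x y
    have := hg.noncrossing x y
    have := f1 x
    have := f1 y
    have := g1 x
    have := g1 y
    have := f0 x
    have := f0 y
    have := g0 x
    have := g0 y
    have := e3 x
    have := e3 y
    have := e4 x
    have := e4 y
    grind

theorem IsMatching.restrict {col : ℕ → Bool} {a b u v : ℕ} {f : ℕ → ℕ} (hf : IsMatching col a b f)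
    (hu : a ≤ u) (hv : v ≤ b) (h : ∀ x, u ≤ x → x < v → u ≤ f x ∧ f x < v) :
    IsMatching col u v (fun x => if u ≤ x ∧ x < v then f x else x) := by
  have fi := hf.invol
  refine ⟨fun x => ?_, fun x hx => ?_, fun x h1 h2 => ?_, fun x y => ?_⟩
  · grind
  · grind
  · have := hf.color x
    grind
  · have := hf.noncrossing x y
    have := h x
    have := h y
    grind

/-- Decomposition of the matchings of an interval at the partner of its first point. -/
theorem matchingCount_first (col : ℕ → Bool) {a b : ℕ} (hab : a < b) :
    matchingCount col a b = ∑ c ∈ Finset.Ioo a b,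
      if col c ≠ col a then matchingCount col (a + 1) c * matchingCount col (c + 1) b else 0 := by
  rw [← Finset.sum_filter]
  set s := (Finset.Ioo a b).filter (fun c => col c ≠ col a) with hs
  rw [← Finset.sum_coe_sort s]
  simp only [matchingCount, ← Nat.card_prod]
  rw [← Nat.card_sigma]
  symm
  have hmem (c : s) : (a < c.1 ∧ c.1 < b) ∧ col c ≠ col a := by
    exact (Finset.mem_filter.1 c.2).imp_left Finset.mem_Ioo.1
  refine Nat.card_congr (Equiv.ofBijective (fun t => ⟨glueMatching a t.1 t.2.1.1 t.2.2.1,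
    isMatching_glue (hmem t.1).1.1 (hmem t.1).1.2 (hmem t.1).2 t.2.1.2 t.2.2.2⟩) ⟨?_, ?_⟩)
  · rintro ⟨⟨c, hc⟩, ⟨f, hf⟩, ⟨g, hg⟩⟩ ⟨⟨c', hc'⟩, ⟨f', hf'⟩, ⟨g', hg'⟩⟩ h
    simp only [Subtype.mk.injEq] at h
    have hh := congrFun h
    have hcc : c = c' := by simpa [glueMatching] using hh a
    subst hcc
    have := hmem ⟨c, hc⟩
    have e1 : f = f' := by
      funext x
      have := hh x
      have := hf.outside x
      have := hf'.outside x
      simp only [glueMatching] at *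
      grind
    have e2 : g = g' := by
      funext x
      have := hh x
      have := hg.outside x
      have := hg'.outside x
      simp only [glueMatching] at *
      grind
    subst e1 e2
    rfl
  · rintro ⟨f, hf⟩
    have m1 := hf.maps le_rfl hab
    have n1 := hf.ne le_rfl hab
    have hi := hf.invol
    have hmaps := fun x => hf.maps (x := x)
    have hc : f a ∈ s := by
      simp only [hs, Finset.mem_filter, Finset.mem_Ioo]
      exact ⟨⟨by omega, m1.2⟩, hf.color a le_rfl hab⟩
    have hin : ∀ x, a + 1 ≤ x → x < f a → a + 1 ≤ f x ∧ f x < f a := by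
      intro x h1 h2
      have := hf.noncrossing a x
      have := hmaps x (by omega) (by omega)
      have : f x ≠ a := fun h => by have := hi x; rw [h] at this; omega
      have : f x ≠ f a := fun h => by have := hi x; rw [h, hi] at this; omega
      omega
    -- A point beyond the first arch cannot have its partner under it, because `hin` applied to that
    -- partner would bring the point itself under the arch.
    have hout : ∀ x, f a + 1 ≤ x → x < b → f a + 1 ≤ f x ∧ f x < b := by
      intro x h1 h2
      have := hmaps x (by omega) (by omega)
      have : f x ≠ a := fun h => by have := hi x; rw [h] at this; omega
      have : f x ≠ f a := fun h => by have := hi x; rw [h, hi] at this; omega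
      have : ¬ (a + 1 ≤ f x ∧ f x < f a) := fun h => by
        have h3 := hin (f x) h.1 h.2
        rw [hi] at h3
        omega
      omega
    refine ⟨⟨⟨f a, hc⟩, ⟨_, hf.restrict (u := a + 1) (v := f a) (by omega) (by omega) hin⟩,
      ⟨_, hf.restrict (u := f a + 1) (by omega) le_rfl hout⟩⟩, ?_⟩
    apply Subtype.ext
    funext x
    have := hf.outside x
    have := hi a
    simp only [glueMatching]
    grind

/-- Decomposition of the matchings of an interval at the partner of its last point. -/
theorem matchingCount_last (col : ℕ → Bool) (n : ℕ) : ∀ a b : ℕ, a ≤ b → b ≤ a + n →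
    matchingCount col a (b + 1) = ∑ c ∈ Finset.Ico a b,
      if col c ≠ col b then matchingCount col a c * matchingCount col (c + 1) b else 0 := by
  induction n with
  | zero =>
    intro a b h1 h2
    obtain rfl : a = b := by omega
    rw [matchingCount_first col (by omega)]
    have : Finset.Ioo a (a + 1) = ∅ := by ext; simp
    simp [this]
  | succ n ih =>
    intro a b h1 h2
    rcases h1.eq_or_lt with rfl | h
    · exact ih a a le_rfl (by omega)
    rw [matchingCount_first col (by omega)]
    have e1 : Finset.Ioo a (b + 1) = insert b (Finset.Ioo a b) := by
      ext x; simp only [Finset.mem_Ioo, Finset.mem_insert]; omega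
    have e2 : Finset.Ico a b = insert a (Finset.Ioo a b) := by
      ext x; simp only [Finset.mem_Ioo, Finset.mem_insert, Finset.mem_Ico]; omega
    rw [e1, e2, Finset.sum_insert (by simp), Finset.sum_insert (by simp)]
    simp only [matchingCount_self, one_mul, mul_one]
    have hne : (col b ≠ col a) ↔ (col a ≠ col b) := ne_comm
    simp only [hne]
    -- The terms in which the first and last points are joined to each other agree. In all others
    -- the two points lie on disjoint arches ending at `c < d`, and both sides expand to the same
    -- double sum over `c` and `d`.
    congr 1
    have l1 : ∀ c ∈ Finset.Ioo a b, (if col c ≠ col a then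
        matchingCount col (a + 1) c * matchingCount col (c + 1) (b + 1) else 0) =
        ∑ d ∈ Finset.Ioo a b, if c < d ∧ col c ≠ col a ∧ col d ≠ col b then
          matchingCount col (a + 1) c * matchingCount col (c + 1) d * matchingCount col (d + 1) b
          else 0 := by
      intro c hc
      rw [Finset.mem_Ioo] at hc
      by_cases hcol : col c ≠ col a
      · rw [if_pos hcol, ih (c + 1) b (by omega) (by omega), Finset.mul_sum]
        have : Finset.Ico (c + 1) b = (Finset.Ioo a b).filter (fun d => c < d) := by
          ext x; simp only [Finset.mem_Ioo, Finset.mem_filter, Finset.mem_Ico]; omega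
        rw [this, Finset.sum_filter]
        refine Finset.sum_congr rfl fun d _ => ?_
        by_cases h1 : c < d <;> by_cases h2 : col d ≠ col b <;> simp [h1, h2, hcol, mul_assoc]
      · simp [hcol]
    have l2 : ∀ d ∈ Finset.Ioo a b, (if col d ≠ col b then
        matchingCount col a d * matchingCount col (d + 1) b else 0) =
        ∑ c ∈ Finset.Ioo a b, if c < d ∧ col c ≠ col a ∧ col d ≠ col b then
          matchingCount col (a + 1) c * matchingCount col (c + 1) d * matchingCount col (d + 1) b
          else 0 := by
      intro d hd
      rw [Finset.mem_Ioo] at hd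
      by_cases hcol : col d ≠ col b
      · rw [if_pos hcol, matchingCount_first col (by omega), Finset.sum_mul]
        have : Finset.Ioo a d = (Finset.Ioo a b).filter (fun c => c < d) := by
          ext x; simp only [Finset.mem_Ioo, Finset.mem_filter]; omega
        rw [this, Finset.sum_filter]
        refine Finset.sum_congr rfl fun c _ => ?_
        by_cases h1 : c < d <;> by_cases h2 : col c ≠ col a <;> simp [h1, h2, hcol]
      · simp [hcol]
    rw [Finset.sum_congr rfl l1, Finset.sum_congr rfl l2, Finset.sum_comm]

/-- A matching of `[a, b)` and a matching of `[a + 1, b + 1)` are the same up to a rotation. -/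
theorem matchingCount_rotate (col : ℕ → Bool) {a b : ℕ} (hab : a ≤ b) (h : col a = col b) :
    matchingCount col (a + 1) (b + 1) = matchingCount col a b := by
  rcases hab.eq_or_lt with rfl | hlt
  · rw [matchingCount_self, matchingCount_self]
  -- Moving the first point of `[a, b)` to the other end keeps its partner and the two intervals
  -- that the arch separates. Hence the two decompositions agree term by term.
  · rw [matchingCount_last col b (a + 1) b (by omega) (by omega), matchingCount_first col hlt, h]
    refine Finset.sum_congr ?_ fun _ _ => rfl
    ext x; simp only [Finset.mem_Ioo, Finset.mem_Ico]; omega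

/-- If an interval has a matching, then it contains as many black points as white ones: a
function which goes up at the black points and down at the white ones has the same value at
both ends. -/
theorem matchingCount_balanced (col : ℕ → Bool) (h : ℕ → ℤ)
    (hh : ∀ x, h (x + 1) = h x + if col x then 1 else -1) (n : ℕ) :
    ∀ a b : ℕ, a ≤ b → b ≤ a + n → matchingCount col a b ≠ 0 → h a = h b := by
  induction n with
  | zero =>
    intro a b h1 h2 _
    rw [show a = b by omega]
  | succ n ih =>
    intro a b h1 h2 h3
    rcases h1.eq_or_lt with rfl | hlt
    · rfl
    rw [matchingCount_first col hlt] at h3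
    obtain ⟨c, hc, h4⟩ := Finset.exists_ne_zero_of_sum_ne_zero h3
    rw [Finset.mem_Ioo] at hc
    have hcol : col c ≠ col a := fun hcol => h4 (by simp [hcol])
    rw [if_pos hcol] at h4
    have i1 := ih (a + 1) c (by omega) (by omega) (left_ne_zero_of_mul h4)
    have i2 := ih (c + 1) b (by omega) (by omega) (right_ne_zero_of_mul h4)
    rw [hh] at i1 i2
    cases ha : col a <;> cases hc' : col c <;> simp_all <;> omega

/-! ### Matchings of a periodic sequence of colored blocks -/

/-- The coloring by blocks of length `k`, alternately black and white. -/
def blockColor (k x : ℕ) : Bool := decide (x / k % 2 = 0)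

/-- The excess of black points over white ones to the left of `x`. -/
def blockHeight (k x : ℕ) : ℤ :=
  if x % (2 * k) < k then ((x % (2 * k) : ℕ) : ℤ) else 2 * k - ((x % (2 * k) : ℕ) : ℤ)

theorem blockColor_eq {k : ℕ} (hk : 0 < k) (x : ℕ) :
    blockColor k x = decide (x % (2 * k) < k) := by
  have h1 := Nat.mod_mul_right_div_self x k 2
  rw [mul_comm k 2] at h1
  simp only [blockColor, ← h1, decide_eq_decide]
  have h2 : x % (2 * k) < 2 * k := Nat.mod_lt _ (by omega)
  rw [Nat.div_eq_zero_iff]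
  omega

theorem blockHeight_succ (k : ℕ) (hk : 0 < k) (x : ℕ) :
    blockHeight k (x + 1) = blockHeight k x + if blockColor k x then 1 else -1 := by
  rw [blockColor_eq hk]
  simp only [blockHeight, decide_eq_true_eq]
  have h2 : x % (2 * k) < 2 * k := Nat.mod_lt _ (by omega)
  have h3 : (x + 1) % (2 * k) = if x % (2 * k) + 1 = 2 * k then 0 else x % (2 * k) + 1 := by
    rw [Nat.add_mod]
    split_ifs with h
    · rcases Nat.lt_or_ge 1 (2 * k) with h1 | h1
      · rw [Nat.mod_eq_of_lt h1, h, Nat.mod_self]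
      · omega
    · rw [Nat.mod_eq_of_lt (show 1 < 2 * k by omega), Nat.mod_eq_of_lt (by omega)]
  rw [h3]
  split_ifs <;> omega

/-- The coloring has period `2 k`, so the point dropped on the left and the one gained on the right
have equal colors, and rotation applies at each unit shift. -/
theorem matchingCount_period {k : ℕ} (hk : 0 < k) (t x : ℕ) :
    matchingCount (blockColor k) x (x + 2 * k * t) =
      matchingCount (blockColor k) 0 (2 * k * t) := by
  induction x with
  | zero => simp
  | succ x ih =>
    rw [← ih, show x + 1 + 2 * k * t = x + 2 * k * t + 1 by ring]
    refine matchingCount_rotate _ (by omega) ?_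
    rw [blockColor_eq hk, blockColor_eq hk, Nat.add_mul_mod_self_left]

/-- The first point is black. The interval under its arch must be balanced, so its partner is a
white point at which the height is `k - i`, that is, some `k + 2 k j + i`. What follows the arch
consists of `m - j` whole periods, up to a shift. -/
theorem matchingCount_block_succ (k i m : ℕ) (hi : i < k) :
    matchingCount (blockColor k) (k - (i + 1)) (k + 2 * k * m + (i + 1)) =
      ∑ j ∈ Finset.range (m + 1), matchingCount (blockColor k) (k - i) (k + 2 * k * j + i) *
        matchingCount (blockColor k) 0 (2 * k * (m - j)) := by
  have hk : 0 < k := by omega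
  rw [matchingCount_first _ (by omega)]
  have hinj : Set.InjOn (fun j => k + 2 * k * j + i) (Finset.range (m + 1) : Set ℕ) := by
    intro j _ j' _ h
    have h' : 2 * k * j = 2 * k * j' := by simp only at h; omega
    exact Nat.eq_of_mul_eq_mul_left (by omega) h'
  have hca : blockColor k (k - (i + 1)) = true := by
    rw [blockColor_eq hk, Nat.mod_eq_of_lt (by omega)]
    simp; omega
  rw [← Finset.sum_subset (s₁ := (Finset.range (m + 1)).image (fun j => k + 2 * k * j + i)),
    Finset.sum_image hinj]
  · refine Finset.sum_congr rfl fun j hj => ?_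
    rw [Finset.mem_range] at hj
    have hcc : blockColor k (k + 2 * k * j + i) = false := by
      rw [blockColor_eq hk, show k + 2 * k * j + i = k + i + 2 * k * j by ring,
        Nat.add_mul_mod_self_left, Nat.mod_eq_of_lt (by omega)]
      simp
    rw [if_pos (by rw [hca, hcc]; simp), show k - (i + 1) + 1 = k - i by omega]
    have : k + 2 * k * m + (i + 1) = k + 2 * k * j + i + 1 + 2 * k * (m - j) := by
      obtain ⟨d, rfl⟩ : ∃ d, m = j + d := ⟨m - j, by omega⟩
      rw [Nat.add_sub_cancel_left]; ring
    rw [this, matchingCount_period hk]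
  · intro c hc
    rw [Finset.mem_image] at hc
    obtain ⟨j, hj, rfl⟩ := hc
    rw [Finset.mem_range] at hj
    have : 2 * k * j ≤ 2 * k * m := Nat.mul_le_mul_left _ (by omega)
    rw [Finset.mem_Ioo]
    omega
  · intro c hc hc'
    rw [Finset.mem_Ioo] at hc
    by_contra h
    have hcol : blockColor k c ≠ blockColor k (k - (i + 1)) := fun h1 => h (by simp [h1])
    rw [if_pos hcol] at h
    -- A nonzero term has a balanced interior; together with whiteness of `c`, the height determines
    -- `c` modulo `2 k`.
    have hb := matchingCount_balanced (blockColor k) (blockHeight k) (blockHeight_succ k hk) c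
      _ c (by omega) (by omega) (left_ne_zero_of_mul h)
    rw [hca, blockColor_eq hk] at hcol
    simp only [ne_eq, decide_eq_true_eq] at hcol
    have hr : c % (2 * k) < 2 * k := Nat.mod_lt _ (by omega)
    have hdiv := Nat.div_add_mod c (2 * k)
    have e1 : k - (i + 1) + 1 = k - i := by omega
    rw [e1] at hb
    simp only [blockHeight] at hb
    rw [if_neg hcol] at hb
    have hcr : c % (2 * k) = k + i := by
      have h3 : (k - i) % (2 * k) = k - i := Nat.mod_eq_of_lt (by omega)
      rw [h3] at hb
      split_ifs at hb <;> omega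
    apply hc'
    rw [Finset.mem_image]
    refine ⟨c / (2 * k), ?_, by omega⟩
    rw [Finset.mem_range]
    have : 2 * k * (c / (2 * k)) < 2 * k * (m + 1) := by rw [Nat.mul_add]; omega
    exact Nat.lt_of_mul_lt_mul_left this

/-- The generating function of the matchings of `2 n` blocks. -/
noncomputable def blockSeries (k : ℕ) : PowerSeries ℕ :=
  PowerSeries.mk fun n => matchingCount (blockColor k) 0 (2 * k * n)

/-- Each of the `i` extra points at the left end contributes one Cauchy product with the series of
whole periods. -/
theorem mk_matchingCount_block {k : ℕ} (hk : 0 < k) (i : ℕ) (hi : i ≤ k) :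
    PowerSeries.mk (fun m => matchingCount (blockColor k) (k - i) (k + 2 * k * m + i)) =
      blockSeries k ^ (i + 1) := by
  induction i with
  | zero =>
    rw [zero_add, pow_one, blockSeries]
    congr 1
    funext m
    rw [Nat.sub_zero, add_zero, matchingCount_period hk]
  | succ i ih =>
    rw [pow_succ, ← ih (by omega)]
    ext m
    rw [PowerSeries.coeff_mul, Finset.Nat.sum_antidiagonal_eq_sum_range_succ_mk]
    simp only [PowerSeries.coeff_mk, blockSeries]
    exact matchingCount_block_succ k i m (by omega)

/-- For `i = k` the interval of `mk_matchingCount_block` is `[0, 2 k (m + 1))`, which is again a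
union of whole periods. So the power `k + 1` of the series is the series itself, shifted by one. -/
theorem blockSeries_eq {k : ℕ} (hk : 0 < k) :
    blockSeries k = 1 + PowerSeries.X * blockSeries k ^ (k + 1) := by
  rw [← mk_matchingCount_block hk k le_rfl]
  ext n
  cases n with
  | zero => simp [blockSeries, matchingCount_self]
  | succ n =>
    rw [map_add, PowerSeries.coeff_succ_X_mul, PowerSeries.coeff_mk, blockSeries,
      PowerSeries.coeff_mk, PowerSeries.coeff_one, if_neg (by omega), zero_add, Nat.sub_self]
    congr 1
    ring

/-! ### Arch systems as matchings -/

/-- The position of a half-arch on the line. -/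
def HalfArch.pos {q N : ℕ} (x : HalfArch q N) : ℕ := (ofLex x).1 * (q - 1) + (ofLex x).2

theorem HalfArch.pos_lt_pos {q N : ℕ} {x y : HalfArch q N} : x.pos < y.pos ↔ x < y := by
  have h1 := (ofLex x).2.2
  have h2 := (ofLex y).2.2
  rw [Prod.Lex.lt_iff]
  unfold HalfArch.pos
  rcases lt_trichotomy (ofLex x).1 (ofLex y).1 with h | h | h
  · have : ((ofLex x).1 + 1 : ℕ) * (q - 1) ≤ (ofLex y).1 * (q - 1) :=
      Nat.mul_le_mul_right _ h
    rw [Nat.add_mul] at this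
    simp only [h, true_or, iff_true]
    omega
  · rw [h, Fin.lt_def (a := (ofLex x).2)]
    simp
  · have : ((ofLex y).1 + 1 : ℕ) * (q - 1) ≤ (ofLex x).1 * (q - 1) :=
      Nat.mul_le_mul_right _ h
    rw [Nat.add_mul] at this
    simp only [h.not_gt, h.ne', false_and, or_self, iff_false]
    omega

theorem HalfArch.pos_lt {q N : ℕ} (x : HalfArch q N) : x.pos < 2 * (q - 1) * N := by
  have h1 := (ofLex x).2.2
  have h : ((ofLex x).1 + 1 : ℕ) * (q - 1) ≤ 2 * N * (q - 1) :=
    Nat.mul_le_mul_right _ (ofLex x).1.2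
  rw [Nat.add_mul] at h
  unfold HalfArch.pos
  rw [show 2 * (q - 1) * N = 2 * N * (q - 1) by ring]
  omega

/-- The half-arches, numbered from left to right. -/
noncomputable def HalfArch.posEquiv (q N : ℕ) : HalfArch q N ≃ Fin (2 * (q - 1) * N) :=
  Equiv.ofBijective (fun x => ⟨x.pos, x.pos_lt⟩) (by
    rw [Fintype.bijective_iff_injective_and_card]
    constructor
    · intro x y h
      have h' : x.pos = y.pos := congrArg Fin.val h
      rcases lt_trichotomy x y with h1 | h1 | h1
      · have := HalfArch.pos_lt_pos.2 h1; omega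
      · exact h1
      · have := HalfArch.pos_lt_pos.2 h1; omega
    · have h : Fintype.card (HalfArch q N) = Fintype.card (Fin (2 * N) × Fin (q - 1)) :=
        Fintype.card_congr ofLex
      rw [h, Fintype.card_prod]
      simp only [Fintype.card_fin]
      ring)

theorem HalfArch.posEquiv_val {q N : ℕ} (x : HalfArch q N) :
    (HalfArch.posEquiv q N x : ℕ) = x.pos := rfl

theorem HalfArch.black_iff {q N : ℕ} (x : HalfArch q N) :
    x.black ↔ blockColor (q - 1) x.pos = true := by
  have h1 := (ofLex x).2.2
  have : x.pos / (q - 1) = (ofLex x).1 := by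
    rw [HalfArch.pos, mul_comm, Nat.mul_add_div (by omega), Nat.div_eq_of_lt h1, add_zero]
  simp [blockColor, this, HalfArch.black, Nat.even_iff]

/-- Transport along the left-to-right numbering of half-arches, with the identity outside. Matchings
of intervals of `ℕ` can be cut into subintervals, which half-arches indexed by a fixed `N` do not
allow. -/
theorem archCount_eq_matchingCount (q N : ℕ) :
    archCount q N = matchingCount (blockColor (q - 1)) 0 (2 * (q - 1) * N) := by
  set L := 2 * (q - 1) * N
  let e : HalfArch q N ≃ Fin L := HalfArch.posEquiv q N
  have hev (x : HalfArch q N) : (e x : ℕ) = x.pos := HalfArch.posEquiv_val x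
  have hes (j : Fin L) : (e.symm j).pos = j := by rw [← hev, Equiv.apply_symm_apply]
  let toFun (f : HalfArch q N → HalfArch q N) (x : ℕ) : ℕ :=
    if h : x < L then (f (e.symm ⟨x, h⟩)).pos else x
  have hto (f : HalfArch q N → HalfArch q N) (x : HalfArch q N) : toFun f x.pos = (f x).pos := by
    have h : (⟨x.pos, x.pos_lt⟩ : Fin L) = e x := rfl
    simp only [toFun]
    rw [dif_pos x.pos_lt, h, Equiv.symm_apply_apply]
  have hex (x : ℕ) (hx : x < L) : ∃ y : HalfArch q N, y.pos = x := ⟨e.symm ⟨x, hx⟩, hes _⟩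
  have hinj {x y : HalfArch q N} (h : x.pos = y.pos) : x = y := e.injective (Fin.ext h)
  have hout (f : HalfArch q N → HalfArch q N) (x : ℕ) (hx : ¬ x < L) : toFun f x = x := dif_neg hx
  have hcol (x y : HalfArch q N) : (x.black ↔ ¬ y.black) ↔
      blockColor (q - 1) x.pos ≠ blockColor (q - 1) y.pos := by
    rw [HalfArch.black_iff, HalfArch.black_iff]
    cases blockColor (q - 1) x.pos <;> cases blockColor (q - 1) y.pos <;> simp
  have hmain (f : HalfArch q N → HalfArch q N) (hf : IsArchSystem f) :
      IsMatching (blockColor (q - 1)) 0 L (toFun f) := by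
    obtain ⟨h1, h2, h3⟩ := hf
    refine ⟨fun x => ?_, fun x hx => hout f x (by omega), fun x _ hx => ?_, fun x y h => ?_⟩
    · by_cases hx : x < L
      · obtain ⟨y, rfl⟩ := hex x hx
        rw [hto, hto, h1]
      · rw [hout f x hx, hout f x hx]
    · obtain ⟨y, rfl⟩ := hex x hx
      rw [hto, ← hcol]
      exact h2 y
    · have hx : x < L := by
        by_contra hx
        rw [hout f x hx] at h
        omega
      obtain ⟨x, rfl⟩ := hex x hx
      rw [hto] at h
      have hy : y < L := h.2.1.trans (HalfArch.pos_lt _)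
      obtain ⟨y, rfl⟩ := hex y hy
      rw [hto] at h
      simp only [HalfArch.pos_lt_pos] at h
      exact h3 x y h
  refine Nat.card_congr (Equiv.ofBijective (fun f => ⟨toFun f.1, hmain f.1 f.2⟩) ⟨?_, ?_⟩)
  · rintro ⟨f, hf⟩ ⟨g, hg⟩ h
    simp only [Subtype.mk.injEq] at h
    apply Subtype.ext
    funext x
    have := congrFun h x.pos
    rw [hto, hto] at this
    exact hinj this
  · rintro ⟨g, hg⟩
    let f (x : HalfArch q N) : HalfArch q N :=
      e.symm ⟨g x.pos, (hg.maps (Nat.zero_le _) x.pos_lt).2⟩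
    have hfp (x : HalfArch q N) : (f x).pos = g x.pos := hes _
    refine ⟨⟨f, fun x => hinj ?_, fun x => ?_, fun x y h => ?_⟩, ?_⟩
    · rw [hfp, hfp, hg.invol]
    · rw [hcol, hfp]
      exact hg.color _ (Nat.zero_le _) x.pos_lt
    · simp only [← HalfArch.pos_lt_pos, hfp] at h
      exact hg.noncrossing _ _ h
    · apply Subtype.ext
      funext x
      by_cases hx : x < L
      · obtain ⟨y, rfl⟩ := hex x hx
        exact (hto f y).trans (hfp y)
      · exact (hout f x hx).trans (hg.outside x (by omega)).symm

theorem mk_archCount (q : ℕ) : PowerSeries.mk (archCount q) = blockSeries (q - 1) := by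
  rw [blockSeries]
  congr 1
  funext N
  exact archCount_eq_matchingCount q N

theorem mk_archCount_eq (q : ℕ) (hq : 2 ≤ q) :
    PowerSeries.mk (archCount q) = 1 + PowerSeries.X * PowerSeries.mk (archCount q) ^ q := by
  rw [mk_archCount]
  nth_rw 1 [blockSeries_eq (by omega)]
  rw [Nat.sub_add_cancel (by omega)]

/-! ### Numbers of cycles of permutations -/

section NumCycles

set_option linter.unusedSectionVars false

open Equiv Equiv.Perm

variable {D : Type} [Fintype D] [DecidableEq D]

/-- The number of cycles of a permutation, fixed points included. -/
noncomputable def numCycles (π : Perm D) : ℕ := Nat.card (Quotient (SameCycle.setoid π))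

/-- The coarsening of an equivalence relation in which the classes of `a` and `b` are merged. -/
def mergeSetoid (r : Setoid D) (a b : D) : Setoid D where
  r x y := r x y ∨ ((r x a ∨ r x b) ∧ (r y a ∨ r y b))
  iseqv := by
    refine ⟨fun x => Or.inl (r.refl x), fun h => ?_, fun h1 h2 => ?_⟩
    · rcases h with h | h
      · exact Or.inl (r.symm h)
      · exact Or.inr h.symm
    · rcases h1 with h1 | ⟨h1, h1'⟩ <;> rcases h2 with h2 | ⟨h2, h2'⟩
      · exact Or.inl (r.trans h1 h2)
      · exact Or.inr ⟨h2.imp (r.trans h1) (r.trans h1), h2'⟩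
      · exact Or.inr ⟨h1, h1'.imp (r.trans (r.symm h2)) (r.trans (r.symm h2))⟩
      · exact Or.inr ⟨h1, h2'⟩

theorem mergeSetoid_of_rel {r : Setoid D} {a b : D} (h : r a b) : mergeSetoid r a b = r := by
  ext x y
  refine ⟨fun hxy => ?_, Or.inl⟩
  have hb : ∀ z, r z a ∨ r z b → r z a := fun z hz => hz.elim id fun hz => r.trans hz (r.symm h)
  rcases hxy with hxy | ⟨hx, hy⟩
  · exact hxy
  · exact r.trans (hb x hx) (r.symm (hb y hy))

/-- Every class of the merged relation comes from exactly one class of `r` other than that of `b`.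
-/
theorem card_quotient_of_not_rel {r : Setoid D} {a b : D} (h : ¬ r a b) :
    Nat.card (Quotient r) = Nat.card (Quotient (mergeSetoid r a b)) + 1 := by
  classical
  let p : Quotient r → Quotient (mergeSetoid r a b) :=
    Quotient.map' id fun x y hxy => Or.inl hxy
  have hbij : Function.Bijective
      (fun c : {c : Quotient r // c ≠ Quotient.mk r b} => p c.1) := by
    constructor
    · rintro ⟨c, hc⟩ ⟨d, hd⟩ hcd
      induction c using Quotient.inductionOn with | _ x => ?_
      induction d using Quotient.inductionOn with | _ y => ?_
      have hx : ¬ r x b := fun h => hc (Quotient.sound h)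
      have hy : ¬ r y b := fun h => hd (Quotient.sound h)
      have hxy : mergeSetoid r a b x y := Quotient.exact hcd
      refine Subtype.ext (Quotient.sound ?_)
      rcases hxy with hxy | ⟨h1, h2⟩
      · exact hxy
      · exact r.trans (h1.resolve_right hx) (r.symm (h2.resolve_right hy))
    · intro c
      induction c using Quotient.inductionOn with | _ x => ?_
      by_cases hx : r x b
      · refine ⟨⟨Quotient.mk r a, fun h' => h (Quotient.exact h')⟩, ?_⟩
        exact Quotient.sound (Or.inr ⟨Or.inl (r.refl a), Or.inr hx⟩)
      · exact ⟨⟨Quotient.mk r x, fun h' => hx (Quotient.exact h')⟩, rfl⟩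
  rw [← Nat.card_congr (Equiv.ofBijective _ hbij),
    Nat.card_congr (Equiv.optionSubtypeNe (Quotient.mk r b)).symm, Finite.card_option]

/-- The two permutations differ only in that the images of `a` and `b` are exchanged. Once `a` and
`b` are identified, a step of `π` stays within a class. -/
theorem mergeSetoid_sameCycle_le (π : Perm D) (a b : D) :
    mergeSetoid (SameCycle.setoid π) a b ≤
      mergeSetoid (SameCycle.setoid (π * swap a b)) a b := by
  set R := mergeSetoid (SameCycle.setoid (π * swap a b)) a b with hR
  have hab : R a b := Or.inr ⟨Or.inl (SameCycle.refl _ a), Or.inr (SameCycle.refl _ b)⟩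
  have hs (x : D) : R x ((π * swap a b) x) := Or.inl (sameCycle_apply_right.2 (SameCycle.refl _ x))
  have h1 (x : D) : R x (π x) := by
    by_cases ha : x = a
    · subst ha
      have := hs b
      rw [Perm.mul_apply, swap_apply_right] at this
      exact R.trans hab this
    by_cases hb : x = b
    · subst hb
      have := hs a
      rw [Perm.mul_apply, swap_apply_left] at this
      exact R.trans (R.symm hab) this
    have := hs x
    rwa [Perm.mul_apply, swap_apply_of_ne_of_ne ha hb] at this
  have h2 (x : D) (n : ℕ) : R x ((π ^ n) x) := by
    induction n with
    | zero => exact R.refl x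
    | succ n ih => rw [pow_succ', Perm.mul_apply]; exact R.trans ih (h1 _)
  have h3 (x y : D) (h : SameCycle π x y) : R x y := by
    obtain ⟨n, _, _, rfl⟩ := h.exists_pow_eq π
    exact h2 x n
  have h4 (x : D) (h : SameCycle π x a ∨ SameCycle π x b) : R x a :=
    h.elim (h3 x a) fun h => R.trans (h3 x b h) (R.symm hab)
  intro x y h
  rcases h with h | ⟨hx, hy⟩
  · exact h3 x y h
  · exact R.trans (h4 x hx) (R.symm (h4 y hy))

/-- Lets the cycle numbers of `π` and `π * swap a b` be compared with one common quotient; the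
reverse inclusion holds because the swap is its own inverse. -/
theorem mergeSetoid_sameCycle (π : Perm D) (a b : D) :
    mergeSetoid (SameCycle.setoid (π * swap a b)) a b = mergeSetoid (SameCycle.setoid π) a b := by
  refine le_antisymm ?_ (mergeSetoid_sameCycle_le π a b)
  have := mergeSetoid_sameCycle_le (π * swap a b) a b
  rwa [mul_assoc, swap_mul_self, mul_one] at this

/-- Multiplication by a transposition of two points of a cycle splits this cycle. -/
theorem not_sameCycle_mul_swap {π : Perm D} {a b : D} (hab : a ≠ b) (h : SameCycle π a b) :
    ¬ SameCycle (π * swap a b) a b := by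
  classical
  have hex : ∃ n, (π ^ n) a = b := by
    obtain ⟨n, _, _, hn⟩ := h.exists_pow_eq π
    exact ⟨n, hn⟩
  set k := Nat.find hex with hk
  have hkb : (π ^ k) a = b := Nat.find_spec hex
  have hmin : ∀ j, j < k → (π ^ j) a ≠ b := fun j hj => Nat.find_min hex hj
  have hk0 : 0 < k := by
    by_contra h0
    have : k = 0 := by omega
    rw [this] at hkb
    exact hab hkb
  have hna : ∀ j, 0 < j → j ≤ k → (π ^ j) a ≠ a := by
    intro j hj0 hjk hja
    have h1 : (π ^ (k - j)) a = b := by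
      rw [← hkb]
      conv_rhs => rw [show k = (k - j) + j by omega, pow_add, Perm.mul_apply, hja]
    exact hmin (k - j) (by omega) h1
  -- The orbit of `b` runs through `π a, …, π ^ k a = b` and closes up there, since the swap sends
  -- `b` to `a` before `π` acts. It never meets `a`.
  have hclosed : ∀ n : ℕ, ∃ j, 0 < j ∧ j ≤ k ∧ ((π * swap a b) ^ n) b = (π ^ j) a := by
    intro n
    induction n with
    | zero => exact ⟨k, hk0, le_rfl, hkb.symm⟩
    | succ n ih =>
      obtain ⟨j, h1, h2, h3⟩ := ih
      rw [pow_succ', Perm.mul_apply, h3, Perm.mul_apply]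
      rcases h2.eq_or_lt with rfl | h4
      · refine ⟨1, one_pos, h1, ?_⟩
        rw [hkb, swap_apply_right, pow_one]
      · refine ⟨j + 1, by omega, h4, ?_⟩
        rw [swap_apply_of_ne_of_ne (hna j h1 h2) (hmin j h4), pow_succ', Perm.mul_apply]
  intro hs
  obtain ⟨n, _, _, hn⟩ := hs.symm.exists_pow_eq (π * swap a b)
  obtain ⟨j, h1, h2, h3⟩ := hclosed n
  exact hna j h1 h2 (h3 ▸ hn)

theorem numCycles_mul_swap {π : Perm D} {a b : D} (hab : a ≠ b) (h : SameCycle π a b) :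
    numCycles (π * swap a b) = numCycles π + 1 := by
  rw [numCycles, card_quotient_of_not_rel (r := SameCycle.setoid (π * swap a b))
    (not_sameCycle_mul_swap hab h), mergeSetoid_sameCycle, mergeSetoid_of_rel h, numCycles]

theorem numCycles_mul_swap_le {π : Perm D} {a b : D} (h : ¬ SameCycle π a b) :
    numCycles (π * swap a b) ≤ numCycles π := by
  rw [numCycles, numCycles, card_quotient_of_not_rel (r := SameCycle.setoid π) h]
  by_cases h' : SameCycle (π * swap a b) a b
  · rw [← mergeSetoid_sameCycle, mergeSetoid_of_rel (r := SameCycle.setoid (π * swap a b)) h']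
    omega
  · rw [card_quotient_of_not_rel (r := SameCycle.setoid (π * swap a b)) h',
      mergeSetoid_sameCycle]

/-! ### Composition with an involution -/

theorem involution_mul_swap {τ : Perm D} (hτ : ∀ x, τ (τ x) = x) {a : D} (x : D) :
    (τ * swap a (τ a)) x = if x = a ∨ x = τ a then x else τ x := by
  rw [Perm.mul_apply]
  split_ifs with h
  · rcases h with rfl | rfl
    · rw [swap_apply_left, hτ]
    · rw [swap_apply_right]
  · rw [not_or] at h
    rw [swap_apply_of_ne_of_ne h.1 h.2]

theorem involution_mul_swap_involutive {τ : Perm D} (hτ : ∀ x, τ (τ x) = x) (a x : D) :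
    (τ * swap a (τ a)) ((τ * swap a (τ a)) x) = x := by
  rw [involution_mul_swap hτ, involution_mul_swap hτ]
  have := hτ x
  have := hτ a
  grind

theorem involution_swap_comm {τ : Perm D} (hτ : ∀ x, τ (τ x) = x) (a : D) :
    swap a (τ a) * (τ * swap a (τ a)) = τ := by
  ext x
  rw [Perm.mul_apply, involution_mul_swap hτ]
  have := hτ x
  have := hτ a
  rw [swap_apply_def]
  grind

theorem card_support_involution_mul_swap {τ : Perm D} (hτ : ∀ x, τ (τ x) = x) {a : D}
    (ha : τ a ≠ a) : (τ * swap a (τ a)).support.card + 2 = τ.support.card := by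
  have h : τ.support = insert a (insert (τ a) (τ * swap a (τ a)).support) := by
    ext x
    simp only [mem_support, Finset.mem_insert, involution_mul_swap hτ]
    have := hτ x
    have := hτ a
    grind
  rw [h, Finset.card_insert_of_notMem, Finset.card_insert_of_notMem]
  · simp [mem_support, involution_mul_swap hτ]
  · simp only [mem_support, Finset.mem_insert, involution_mul_swap hτ]
    grind

/-- Each transposition of the involution raises the number of cycles by at most one. The support
counts every transposition twice, hence the factors `2`. -/
theorem numCycles_mul_involution_le (n : ℕ) (ρ τ : Perm D) (hτ : ∀ x, τ (τ x) = x)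
    (hn : τ.support.card ≤ n) : 2 * numCycles (ρ * τ) ≤ 2 * numCycles ρ + τ.support.card := by
  induction n generalizing τ with
  | zero =>
    have : τ = 1 := by rw [← support_eq_empty_iff, ← Finset.card_eq_zero]; omega
    simp [this]
  | succ n ih =>
    by_cases h : τ = 1
    · simp [h]
    obtain ⟨a, ha⟩ : ∃ a, τ a ≠ a := by
      by_contra h'
      push Not at h'
      exact h (Equiv.ext h')
    have hc := card_support_involution_mul_swap hτ ha
    have ih' := ih (τ * swap a (τ a)) (involution_mul_swap_involutive hτ a) (by omega)
    have e : ρ * τ = ρ * (τ * swap a (τ a)) * swap a (τ a) := by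
      rw [← mul_assoc, mul_assoc (ρ * τ), swap_mul_self, mul_one]
    have h1 : numCycles (ρ * τ) ≤ numCycles (ρ * (τ * swap a (τ a))) + 1 := by
      rw [e]
      by_cases hs : SameCycle (ρ * (τ * swap a (τ a))) a (τ a)
      · exact (numCycles_mul_swap ha.symm hs).le
      · exact (numCycles_mul_swap_le hs).trans (Nat.le_succ _)
    omega

/-- If the composition with an involution produces as many cycles as possible, then each of its
transpositions splits a cycle. -/
theorem sameCycle_of_numCycles_eq {ρ τ : Perm D} (hτ : ∀ x, τ (τ x) = x)
    (h : 2 * numCycles (ρ * τ) = 2 * numCycles ρ + τ.support.card) {a : D} (ha : τ a ≠ a) :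
    SameCycle ρ a (τ a) ∧ 2 * numCycles (ρ * swap a (τ a) * (τ * swap a (τ a))) =
      2 * numCycles (ρ * swap a (τ a)) + (τ * swap a (τ a)).support.card := by
  have hle := numCycles_mul_involution_le _ (ρ * swap a (τ a)) (τ * swap a (τ a))
    (involution_mul_swap_involutive hτ a) le_rfl
  have hc := card_support_involution_mul_swap hτ ha
  have e : ρ * swap a (τ a) * (τ * swap a (τ a)) = ρ * τ := by
    rw [mul_assoc, involution_swap_comm hτ]
  by_cases hs : SameCycle ρ a (τ a)
  · have h1 := numCycles_mul_swap ha.symm hs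
    exact ⟨hs, by rw [e]; omega⟩
  -- A transposition that does not split a cycle leaves too few others to reach the maximum.
  · have h1 := numCycles_mul_swap_le hs
    rw [e] at hle
    omega

/-- Along each cycle of `ρ`, the function `pos` goes up by one at each step, until it has reached
its greatest value on this cycle. -/
structure IsCyclePos (ρ : Perm D) (pos : D → ℕ) : Prop where
  inj : Function.Injective pos
  succ : ∀ x y, SameCycle ρ x y → pos x < pos y → pos (ρ x) = pos x + 1

theorem IsCyclePos.pos_pow {ρ : Perm D} {pos : D → ℕ} (h : IsCyclePos ρ pos) {x y : D}
    (hxy : SameCycle ρ x y) (j : ℕ) (hj : pos x + j ≤ pos y) : pos ((ρ ^ j) x) = pos x + j := by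
  induction j with
  | zero => rfl
  | succ j ih =>
    have ih' := ih (by omega)
    rw [pow_succ', Perm.mul_apply, h.succ _ y (sameCycle_pow_left.2 hxy) (by omega), ih']
    omega

theorem IsCyclePos.sameCycle_of_mem {ρ : Perm D} {pos : D → ℕ} (h : IsCyclePos ρ pos) {x y z : D}
    (hxy : SameCycle ρ x y) (h1 : pos x ≤ pos z) (h2 : pos z ≤ pos y) : SameCycle ρ z y := by
  have h3 := h.pos_pow hxy (pos z - pos x) (by omega)
  have h4 : (ρ ^ (pos z - pos x)) x = z := h.inj (by omega)
  rw [← h4]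
  exact sameCycle_pow_left.2 hxy

/-- The arch at `x` can be composed with `ρ` first, and it splits its cycle. The part containing `y`
is then confined to positions above `pos x` and up to `pos (τ x)`. The arch at `y` must split a
cycle in turn, so `τ y` lies in the same part and cannot be beyond `τ x`. -/
theorem noncrossing_of_numCycles_eq {ρ τ : Perm D} {pos : D → ℕ} (hpos : IsCyclePos ρ pos)
    (hτ : ∀ x, τ (τ x) = x) (h : 2 * numCycles (ρ * τ) = 2 * numCycles ρ + τ.support.card)
    (x y : D) : ¬ (pos x < pos y ∧ pos y < pos (τ x) ∧ pos (τ x) < pos (τ y)) := by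
  rintro ⟨h1, h2, h3⟩
  have hx : τ x ≠ x := fun hx => by rw [hx] at h2; omega
  have hyx : y ≠ x := fun e => by rw [e] at h1; omega
  have hyx' : y ≠ τ x := fun e => by rw [e] at h2; omega
  obtain ⟨hs, h'⟩ := sameCycle_of_numCycles_eq hτ h hx
  have hy : (τ * swap x (τ x)) y = τ y := by rw [involution_mul_swap hτ, if_neg (by tauto)]
  have hyy : (τ * swap x (τ x)) y ≠ y := by
    rw [hy]
    intro e
    rw [e] at h3
    omega
  obtain ⟨hs', -⟩ := sameCycle_of_numCycles_eq (involution_mul_swap_involutive hτ x) h' hyy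
  rw [hy] at hs'
  obtain ⟨n, _, _, hn⟩ := hs'.exists_pow_eq _
  have hinv : ∀ n : ℕ, pos x < pos (((ρ * swap x (τ x)) ^ n) y) ∧
      pos (((ρ * swap x (τ x)) ^ n) y) ≤ pos (τ x) := by
    intro n
    induction n with
    | zero => exact ⟨h1, h2.le⟩
    | succ n ih =>
      rw [pow_succ', Perm.mul_apply]
      set z := ((ρ * swap x (τ x)) ^ n) y
      rw [Perm.mul_apply]
      have hzx : z ≠ x := fun e => by rw [e] at ih; omega
      by_cases hz : z = τ x
      · rw [hz, swap_apply_right, hpos.succ x (τ x) hs (by omega)]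
        omega
      · have hz' : pos z ≠ pos (τ x) := fun e => hz (hpos.inj e)
        rw [swap_apply_of_ne_of_ne hzx hz,
          hpos.succ z (τ x) (hpos.sameCycle_of_mem hs (by omega) (by omega)) (by omega)]
        omega
  have := hinv n
  rw [hn] at this
  omega

/-- Remove the arch whose left end is furthest to the right. By the choice and by non-crossing, no
other arch ends under it, so after its removal the product still follows `ρ` from one end to the
other. Restoring the arch therefore splits a cycle, and induction applies to the rest. -/
theorem numCycles_eq_of_noncrossing (n : ℕ) {ρ τ : Perm D} {pos : D → ℕ} (hpos : IsCyclePos ρ pos)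
    (hτ : ∀ x, τ (τ x) = x) (hs : ∀ x, SameCycle ρ x (τ x))
    (hnc : ∀ x y, ¬ (pos x < pos y ∧ pos y < pos (τ x) ∧ pos (τ x) < pos (τ y)))
    (hn : τ.support.card ≤ n) : 2 * numCycles (ρ * τ) = 2 * numCycles ρ + τ.support.card := by
  induction n generalizing τ with
  | zero =>
    have : τ = 1 := by rw [← support_eq_empty_iff, ← Finset.card_eq_zero]; omega
    simp [this]
  | succ n ih =>
    by_cases h : τ = 1
    · simp [h]
    have hne : (Finset.univ.filter fun x => pos x < pos (τ x)).Nonempty := by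
      obtain ⟨a, ha⟩ : ∃ a, τ a ≠ a := by
        by_contra h'
        push Not at h'
        exact h (Equiv.ext h')
      have ha' : pos (τ a) ≠ pos a := fun e => ha (hpos.inj e)
      rcases Nat.lt_or_ge (pos a) (pos (τ a)) with h1 | h1
      · exact ⟨a, by simpa using h1⟩
      · refine ⟨τ a, ?_⟩
        simp only [Finset.mem_filter, Finset.mem_univ, true_and, hτ]
        omega
    obtain ⟨a, ha, hmax⟩ := Finset.exists_max_image _ pos hne
    simp only [Finset.mem_filter, Finset.mem_univ, true_and] at ha hmax
    have ha' : τ a ≠ a := fun e => by rw [e] at ha; omega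
    have hc := card_support_involution_mul_swap hτ ha'
    set τ' := τ * swap a (τ a) with hτ'
    have happ : ∀ x, τ' x = if x = a ∨ x = τ a then x else τ x := fun x =>
      involution_mul_swap hτ x
    have hfix : ∀ x, pos a ≤ pos x → pos x < pos (τ a) → τ' x = x := by
      intro x h1 h2
      rw [happ]
      split_ifs with hx
      · rfl
      · rw [not_or] at hx
        have n1 : pos x ≠ pos a := fun e => hx.1 (hpos.inj e)
        have n2 : pos (τ x) ≠ pos (τ a) := fun e => hx.1 (τ.injective (hpos.inj e))
        have n3 : pos (τ x) ≠ pos a := fun e => hx.2 (by rw [← hpos.inj e, hτ])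
        have c1 := hnc a x
        have c2 := hnc (τ x) a
        have m1 := hmax x
        have m2 := hmax (τ x)
        rw [hτ] at c2 m2
        exact hpos.inj (by omega)
    have ih' := ih (τ := τ') (involution_mul_swap_involutive hτ a)
      (fun x => by
        rw [happ]
        split_ifs
        · exact SameCycle.refl _ _
        · exact hs x)
      (fun x y => by
        have := hnc x y
        rw [happ, happ]
        split_ifs <;> omega)
      (by omega)
    have hpow : ∀ j, pos a + j ≤ pos (τ a) → ((ρ * τ') ^ j) a = (ρ ^ j) a := by
      intro j hj
      induction j with
      | zero => rfl
      | succ j ihj =>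
        have hp := hpos.pos_pow (hs a) j (by omega)
        rw [pow_succ', Perm.mul_apply, ihj (by omega), Perm.mul_apply,
          hfix _ (by omega) (by omega), pow_succ', Perm.mul_apply]
    have hsame : SameCycle (ρ * τ') a (τ a) := by
      have e1 := hpow (pos (τ a) - pos a) (by omega)
      have e2 := hpos.pos_pow (hs a) (pos (τ a) - pos a) (by omega)
      have e3 : (ρ ^ (pos (τ a) - pos a)) a = τ a := hpos.inj (by omega)
      rw [e3] at e1
      exact e1 ▸ sameCycle_pow_right.2 (SameCycle.refl _ _)
    have e : ρ * τ = ρ * τ' * swap a (τ a) := by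
      rw [hτ', mul_assoc, mul_assoc, swap_mul_self, mul_one]
    have := numCycles_mul_swap ha'.symm hsame
    rw [e]
    omega

/-- The composition of `ρ` with an involution has the greatest possible number of cycles if and
only if the involution is a non-crossing system of arches on the cycles of `ρ`. -/
theorem numCycles_mul_involution_eq_iff {ρ τ : Perm D} {pos : D → ℕ} (hpos : IsCyclePos ρ pos)
    (hτ : ∀ x, τ (τ x) = x) :
    2 * numCycles (ρ * τ) = 2 * numCycles ρ + τ.support.card ↔
      (∀ x, SameCycle ρ x (τ x)) ∧
      ∀ x y, ¬ (pos x < pos y ∧ pos y < pos (τ x) ∧ pos (τ x) < pos (τ y)) := by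
  refine ⟨fun h => ⟨fun x => ?_, noncrossing_of_numCycles_eq hpos hτ h⟩,
    fun h => numCycles_eq_of_noncrossing _ hpos hτ h.1 h.2 le_rfl⟩
  by_cases hx : τ x = x
  · rw [hx]
  · exact (sameCycle_of_numCycles_eq hτ h hx).1

end NumCycles

/-! ### Two cycles of equal length -/

/-- `R` and `S` run through the two cycles of `ρ`, both of length `m`. -/
structure IsTwoCycles {D : Type} (ρ : Equiv.Perm D) (m : ℕ) (R S : ℕ → D) : Prop where
  succR : ∀ t, ρ (R t) = R (t + 1)
  succS : ∀ t, ρ (S t) = S (t + 1)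
  periodR : R m = R 0
  periodS : S m = S 0
  injR : ∀ s t, s < m → t < m → R s = R t → s = t
  injS : ∀ s t, s < m → t < m → S s = S t → s = t
  disj : ∀ s t, s < m → t < m → R s ≠ S t
  surj : ∀ d, ∃ t, t < m ∧ (d = R t ∨ d = S t)

/-- The first cycle receives the positions below `m` and the second those from `m` to `2 m - 1`, so
that a single function records both the side and the order. -/
theorem IsTwoCycles.exists_pos {D : Type} [Fintype D] {ρ : Equiv.Perm D} {m : ℕ}
    {R S : ℕ → D} (h : IsTwoCycles ρ m R S) (hm : 0 < m) :
    ∃ pos : D → ℕ, IsCyclePos ρ pos ∧ (∀ t, t < m → pos (R t) = t) ∧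
      (∀ t, t < m → pos (S t) = m + t) ∧
      (∀ x y, Equiv.Perm.SameCycle ρ x y ↔ (pos x < m ↔ pos y < m)) ∧ numCycles ρ = 2 := by
  classical
  have hex (d : D) : ∃ u, (u < m ∧ d = R u) ∨ (m ≤ u ∧ u < 2 * m ∧ d = S (u - m)) := by
    obtain ⟨t, ht, rfl | rfl⟩ := h.surj d
    · exact ⟨t, Or.inl ⟨ht, rfl⟩⟩
    · refine ⟨m + t, Or.inr ⟨by omega, by omega, ?_⟩⟩
      rw [Nat.add_sub_cancel_left]
  choose pos hpos using hex
  have hR : ∀ t, t < m → pos (R t) = t := by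
    intro t ht
    rcases hpos (R t) with ⟨h1, h2⟩ | ⟨h1, h2, h3⟩
    · exact h.injR _ _ h1 ht h2.symm
    · exact absurd h3 (h.disj _ _ ht (by omega))
  have hS : ∀ t, t < m → pos (S t) = m + t := by
    intro t ht
    rcases hpos (S t) with ⟨h1, h2⟩ | ⟨h1, h2, h3⟩
    · exact absurd h2.symm (h.disj _ _ h1 ht)
    · have := h.injS _ _ ht (by omega) h3
      omega
  have hρ : ∀ x, (pos (ρ x) < m ↔ pos x < m) ∧
      (pos x + 1 ≠ m → pos x + 1 < 2 * m → pos (ρ x) = pos x + 1) := by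
    intro x
    obtain ⟨t, ht, rfl | rfl⟩ := h.surj x
    · rw [h.succR, hR t ht]
      by_cases e : t + 1 = m
      · rw [e, h.periodR, hR 0 hm]
        omega
      · rw [hR (t + 1) (by omega)]
        omega
    · rw [h.succS, hS t ht]
      by_cases e : t + 1 = m
      · rw [e, h.periodS, hS 0 hm]
        omega
      · rw [hS (t + 1) (by omega)]
        omega
  have hpowR : ∀ t, (ρ ^ t) (R 0) = R t := by
    intro t
    induction t with
    | zero => rfl
    | succ t ih => rw [pow_succ', Equiv.Perm.mul_apply, ih, h.succR]
  have hpowS : ∀ t, (ρ ^ t) (S 0) = S t := by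
    intro t
    induction t with
    | zero => rfl
    | succ t ih => rw [pow_succ', Equiv.Perm.mul_apply, ih, h.succS]
  have hsR : ∀ t, Equiv.Perm.SameCycle ρ (R 0) (R t) := fun t => ⟨t, by simpa using hpowR t⟩
  have hsS : ∀ t, Equiv.Perm.SameCycle ρ (S 0) (S t) := fun t => ⟨t, by simpa using hpowS t⟩
  have hlt : ∀ x, pos x < 2 * m := by
    intro x
    rcases hpos x with ⟨h1, -⟩ | ⟨-, h2, -⟩ <;> omega
  have hsame : ∀ x y, Equiv.Perm.SameCycle ρ x y ↔ (pos x < m ↔ pos y < m) := by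
    intro x y
    constructor
    · intro hxy
      obtain ⟨n, _, _, rfl⟩ := hxy.exists_pow_eq ρ
      have : ∀ n : ℕ, pos x < m ↔ pos ((ρ ^ n) x) < m := by
        intro n
        induction n with
        | zero => rfl
        | succ n ih => rw [pow_succ', Equiv.Perm.mul_apply, (hρ _).1, ih]
      exact this n
    · intro hxy
      obtain ⟨s, hs, rfl | rfl⟩ := h.surj x <;> obtain ⟨t, ht, rfl | rfl⟩ := h.surj y
      · exact (hsR s).symm.trans (hsR t)
      · rw [hR s hs, hS t ht] at hxy; omega
      · rw [hS s hs, hR t ht] at hxy; omega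
      · exact (hsS s).symm.trans (hsS t)
  refine ⟨pos, ⟨?_, ?_⟩, hR, hS, hsame, ?_⟩
  · intro x y hxy
    obtain ⟨s, hs, rfl | rfl⟩ := h.surj x <;> obtain ⟨t, ht, rfl | rfl⟩ := h.surj y
    · rw [hR s hs, hR t ht] at hxy; rw [hxy]
    · rw [hR s hs, hS t ht] at hxy; omega
    · rw [hS s hs, hR t ht] at hxy; omega
    · rw [hS s hs, hS t ht] at hxy; rw [show s = t by omega]
  · intro x y hxy hlt'
    have := (hsame x y).1 hxy
    have := hlt y
    exact (hρ x).2 (by omega) (by omega)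
  · let b : Quotient (Equiv.Perm.SameCycle.setoid ρ) → Bool :=
      Quotient.lift (fun x => decide (pos x < m))
        fun x y hxy => by rw [decide_eq_decide]; exact (hsame x y).1 hxy
    have hb : Function.Bijective b := by
      constructor
      · intro c d hcd
        induction c using Quotient.inductionOn with | _ x => ?_
        induction d using Quotient.inductionOn with | _ y => ?_
        exact Quotient.sound ((hsame x y).2 (decide_eq_decide.1 hcd))
      · intro c
        cases c
        · refine ⟨Quotient.mk _ (S 0), ?_⟩
          have := hS 0 hm
          simp [b, this]
        · refine ⟨Quotient.mk _ (R 0), ?_⟩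
          have := hR 0 hm
          simp [b, this, hm]
    rw [numCycles, Nat.card_congr (Equiv.ofBijective b hb)]
    simp

/-! ### Darts along a Hamiltonian cycle -/

/-- `L i k` runs through the darts: `i` numbers the `2 N` vertices, and `k` the `2 q` darts at the
vertex `i`. -/
structure IsDartGrid {D : Type} (q N : ℕ) (L : ℕ → ℕ → D) : Prop where
  vperiod : ∀ i k, L (i + 2 * N) k = L i k
  dperiod : ∀ i k, L i (k + 2 * q) = L i k
  inj : ∀ i j k l, i < 2 * N → j < 2 * N → k < 2 * q → l < 2 * q → L i k = L j l → i = j ∧ k = l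
  surj : ∀ d, ∃ i k, i < 2 * N ∧ k < 2 * q ∧ d = L i k

/-- In the map `M`, the darts `L i 0, L i 1, …` follow each other counterclockwise around the vertex
`i`, and the edge of `L i 0` leads to the vertex `i + 1`, where it is opposite to the edge which
leads to the vertex `i + 2`. -/
structure IsFrame {D : Type} (M : CombMap D) (q N : ℕ) (L : ℕ → ℕ → D) : Prop
    extends IsDartGrid q N L where
  rot_eq : ∀ i k, M.rot (L i k) = L i (k + 1)
  opp_eq : ∀ i, M.opp (L i 0) = L (i + 1) q

/-- The darts of the edges of the Hamiltonian cycle. -/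
def gridCycle {D : Type} (q : ℕ) (L : ℕ → ℕ → D) : Set D := {d | ∃ i, d = L i 0 ∨ d = L i q}

/-- The half-arches on the left of the Hamiltonian cycle. -/
def leftDart {D : Type} {q N : ℕ} (L : ℕ → ℕ → D) (x : HalfArch q N) : D :=
  -- Counterclockwise from the outgoing edge, the darts on the left are met from right to left,
  -- hence the reversed index.
  L (ofLex x).1 (q - 1 - (ofLex x).2)

/-- The half-arches on the right of the Hamiltonian cycle. -/
def rightDart {D : Type} {q N : ℕ} (L : ℕ → ℕ → D) (x : HalfArch q N) : D :=
  L (ofLex x).1 (q + 1 + (ofLex x).2)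

section Grid

variable {D : Type} {q N : ℕ} {L : ℕ → ℕ → D}

theorem HalfArch.ext_val {x y : HalfArch q N} (h1 : ((ofLex x).1 : ℕ) = (ofLex y).1)
    (h2 : ((ofLex x).2 : ℕ) = (ofLex y).2) : x = y :=
  ofLex.injective (Prod.ext (Fin.ext h1) (Fin.ext h2))

namespace IsDartGrid

theorem mod_eq (h : IsDartGrid q N L) (i k : ℕ) : L (i % (2 * N)) (k % (2 * q)) = L i k := by
  have h1 (i k n : ℕ) : L (i + 2 * N * n) k = L i k := by
    induction n with
    | zero => rfl
    | succ n ih => rw [Nat.mul_succ, ← add_assoc, h.vperiod, ih]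
  have h2 (i k n : ℕ) : L i (k + 2 * q * n) = L i k := by
    induction n with
    | zero => rfl
    | succ n ih => rw [Nat.mul_succ, ← add_assoc, h.dperiod, ih]
  conv_rhs => rw [← Nat.mod_add_div i (2 * N), ← Nat.mod_add_div k (2 * q), h1, h2]

theorem eq_iff (h : IsDartGrid q N L) (hq : 0 < q) (hN : 0 < N) (i j k l : ℕ) :
    L i k = L j l ↔ i % (2 * N) = j % (2 * N) ∧ k % (2 * q) = l % (2 * q) := by
  constructor
  · intro e
    rw [← h.mod_eq i k, ← h.mod_eq j l] at e
    exact h.inj _ _ _ _ (Nat.mod_lt _ (by omega)) (Nat.mod_lt _ (by omega))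
      (Nat.mod_lt _ (by omega)) (Nat.mod_lt _ (by omega)) e
  · rintro ⟨h1, h2⟩
    rw [← h.mod_eq i k, ← h.mod_eq j l, h1, h2]

theorem mem_gridCycle (h : IsDartGrid q N L) (hq : 0 < q) (hN : 0 < N) (i k : ℕ)
    (hk : k < 2 * q) : L i k ∈ gridCycle q L ↔ k = 0 ∨ k = q := by
  constructor
  · rintro ⟨j, hj | hj⟩
    · have := ((h.eq_iff hq hN _ _ _ _).1 hj).2
      rw [Nat.mod_eq_of_lt hk, Nat.zero_mod] at this
      exact Or.inl this
    · have := ((h.eq_iff hq hN _ _ _ _).1 hj).2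
      rw [Nat.mod_eq_of_lt hk, Nat.mod_eq_of_lt (by omega)] at this
      exact Or.inr this
  · rintro (rfl | rfl)
    · exact ⟨i, Or.inl rfl⟩
    · exact ⟨i, Or.inr rfl⟩

theorem leftDart_notMem (h : IsDartGrid q N L) (hN : 0 < N) (x : HalfArch q N) :
    leftDart L x ∉ gridCycle q L := by
  have := (ofLex x).2.2
  rw [leftDart, h.mem_gridCycle (by omega) hN _ _ (by omega)]
  omega

theorem rightDart_notMem (h : IsDartGrid q N L) (hN : 0 < N) (x : HalfArch q N) :
    rightDart L x ∉ gridCycle q L := by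
  have := (ofLex x).2.2
  rw [rightDart, h.mem_gridCycle (by omega) hN _ _ (by omega)]
  omega

theorem leftDart_injective (h : IsDartGrid q N L) :
    Function.Injective (leftDart L : HalfArch q N → D) := by
  intro x y e
  have h1 := (ofLex x).2.2
  have h2 := (ofLex y).2.2
  obtain ⟨e1, e2⟩ := h.inj _ _ _ _ (ofLex x).1.2 (ofLex y).1.2 (by omega) (by omega) e
  exact HalfArch.ext_val e1 (by omega)

theorem rightDart_injective (h : IsDartGrid q N L) :
    Function.Injective (rightDart L : HalfArch q N → D) := by
  intro x y e
  have h1 := (ofLex x).2.2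
  have h2 := (ofLex y).2.2
  obtain ⟨e1, e2⟩ := h.inj _ _ _ _ (ofLex x).1.2 (ofLex y).1.2 (by omega) (by omega) e
  exact HalfArch.ext_val e1 (by omega)

theorem leftDart_ne_rightDart (h : IsDartGrid q N L) (x y : HalfArch q N) :
    leftDart L x ≠ rightDart L y := by
  intro e
  have h1 := (ofLex x).2.2
  have h2 := (ofLex y).2.2
  obtain ⟨e1, e2⟩ := h.inj _ _ _ _ (ofLex x).1.2 (ofLex y).1.2 (by omega) (by omega) e
  omega

theorem dart_cases (h : IsDartGrid q N L) (d : D) :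
    (∃ i, i < 2 * N ∧ d = L i 0) ∨ (∃ i, i < 2 * N ∧ d = L i q) ∨
      (∃ x : HalfArch q N, d = leftDart L x) ∨ ∃ x : HalfArch q N, d = rightDart L x := by
  obtain ⟨i, k, hi, hk, rfl⟩ := h.surj d
  rcases Nat.eq_zero_or_pos k with rfl | hk0
  · exact Or.inl ⟨i, hi, rfl⟩
  rcases lt_trichotomy k q with hkq | rfl | hkq
  · refine Or.inr (Or.inr (Or.inl ⟨toLex (⟨i, hi⟩, ⟨q - 1 - k, by omega⟩), ?_⟩))
    simp only [leftDart, ofLex_toLex]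
    congr 1
    omega
  · exact Or.inr (Or.inl ⟨i, hi, rfl⟩)
  · refine Or.inr (Or.inr (Or.inr ⟨toLex (⟨i, hi⟩, ⟨k - q - 1, by omega⟩), ?_⟩))
    simp only [rightDart, ofLex_toLex]
    congr 1
    omega

/-- The enumeration of the darts by a product. -/
noncomputable def equiv (h : IsDartGrid q N L) : Fin (2 * N) × Fin (2 * q) ≃ D :=
  Equiv.ofBijective (fun x => L x.1 x.2) (by
    constructor
    · intro x y e
      obtain ⟨e1, e2⟩ := h.inj _ _ _ _ x.1.2 y.1.2 x.2.2 y.2.2 e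
      exact Prod.ext (Fin.ext e1) (Fin.ext e2)
    · intro d
      obtain ⟨i, k, hi, hk, rfl⟩ := h.surj d
      exact ⟨(⟨i, hi⟩, ⟨k, hk⟩), rfl⟩)

theorem equiv_apply (h : IsDartGrid q N L) (x : Fin (2 * N) × Fin (2 * q)) :
    h.equiv x = L x.1 x.2 := rfl

theorem card (h : IsDartGrid q N L) : Nat.card D = 4 * q * N := by
  rw [← Nat.card_congr h.equiv, Nat.card_prod, Nat.card_fin, Nat.card_fin]
  ring

end IsDartGrid

end Grid

namespace IsFrame

variable {D : Type} {q N : ℕ} {L : ℕ → ℕ → D} {M : CombMap D}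

theorem rot_pow (h : IsFrame M q N L) (i k n : ℕ) : (M.rot ^ n) (L i k) = L i (k + n) := by
  induction n with
  | zero => rfl
  | succ n ih => rw [pow_succ', Equiv.Perm.mul_apply, ih, h.rot_eq, add_assoc]

theorem opp_eq' (h : IsFrame M q N L) (i : ℕ) : M.opp (L (i + 1) q) = L i 0 := by
  rw [← h.opp_eq, M.opp_opp]

theorem opp_eq_pred (h : IsFrame M q N L) (hN : 0 < N) (i : ℕ) :
    M.opp (L i q) = L (i + (2 * N - 1)) 0 := by
  rw [← h.opp_eq', ← h.vperiod]
  congr 2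
  omega

theorem opp_mem_gridCycle (h : IsFrame M q N L) (hN : 0 < N) {d : D} (hd : d ∈ gridCycle q L) :
    M.opp d ∈ gridCycle q L := by
  obtain ⟨i, rfl | rfl⟩ := hd
  · exact ⟨i + 1, Or.inr (h.opp_eq i)⟩
  · exact ⟨_, Or.inl (h.opp_eq_pred hN i)⟩

theorem vertexOf_eq (h : IsFrame M q N L) (i k : ℕ) : M.vertexOf (L i k) = M.vertexOf (L i 0) := by
  refine Quotient.sound (Equiv.Perm.SameCycle.symm ⟨(k : ℤ), ?_⟩)
  rw [zpow_natCast, h.rot_pow, zero_add]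

theorem isRigid (h : IsFrame M q N L) (hq : 0 < q) (hN : 0 < N) :
    M.IsRigid q (gridCycle q L) := by
  rintro d ⟨i, rfl | rfl⟩
  · refine ⟨fun k hk0 hkq => ?_, ?_⟩
    · rw [h.rot_pow, h.mem_gridCycle hq hN _ _ (by omega)]
      omega
    · rw [h.rot_pow, zero_add]
      exact ⟨i, Or.inr rfl⟩
  · refine ⟨fun k hk0 hkq => ?_, ?_⟩
    · rw [h.rot_pow, h.mem_gridCycle hq hN _ _ (by omega)]
      omega
    · rw [h.rot_pow, ← two_mul]
      exact ⟨i, Or.inl (by rw [← h.dperiod i 0, zero_add])⟩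

theorem connected (h : IsFrame M q N L) : M.Connected := by
  set G := Subgroup.closure ({M.rot, M.opp} : Set (Equiv.Perm D)) with hG
  have hrot : M.rot ∈ G := Subgroup.subset_closure (by simp)
  have hopp : M.opp ∈ G := Subgroup.subset_closure (by simp)
  have h0 : ∀ i, ∃ g ∈ G, g (L 0 0) = L i 0 := by
    intro i
    induction i with
    | zero => exact ⟨1, G.one_mem, rfl⟩
    | succ i ih =>
      obtain ⟨g, hg, e⟩ := ih
      refine ⟨M.rot ^ q * (M.opp * g), G.mul_mem (G.pow_mem hrot _) (G.mul_mem hopp hg), ?_⟩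
      rw [Equiv.Perm.mul_apply, Equiv.Perm.mul_apply, e, h.opp_eq, h.rot_pow, ← two_mul,
        ← h.dperiod (i + 1) 0, zero_add]
  have h1 : ∀ d, ∃ g ∈ G, g (L 0 0) = d := by
    intro d
    obtain ⟨i, k, -, -, rfl⟩ := h.surj d
    obtain ⟨g, hg, e⟩ := h0 i
    refine ⟨M.rot ^ k * g, G.mul_mem (G.pow_mem hrot _) hg, ?_⟩
    rw [Equiv.Perm.mul_apply, e, h.rot_pow, zero_add]
  intro d e
  obtain ⟨g, hg, rfl⟩ := h1 d
  obtain ⟨g', hg', rfl⟩ := h1 e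
  refine ⟨g' * g⁻¹, G.mul_mem hg' (G.inv_mem hg), ?_⟩
  simp

variable [Fintype D]

theorem vertexOf_eq_iff (h : IsFrame M q N L) (hq : 0 < q) (hN : 0 < N) (i j k l : ℕ) :
    M.vertexOf (L i k) = M.vertexOf (L j l) ↔ i % (2 * N) = j % (2 * N) := by
  classical
  constructor
  · intro e
    have hs : Equiv.Perm.SameCycle M.rot (L i k) (L j l) := Quotient.exact e
    obtain ⟨n, _, _, hn⟩ := hs.exists_pow_eq M.rot
    rw [h.rot_pow] at hn
    exact ((h.eq_iff hq hN _ _ _ _).1 hn).1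
  · intro e
    rw [h.vertexOf_eq i k, h.vertexOf_eq j l]
    congr 1
    exact (h.eq_iff hq hN _ _ _ _).2 ⟨e, rfl⟩

theorem regular (h : IsFrame M q N L) (hq : 0 < q) (hN : 0 < N) : M.Regular (2 * q) := by
  intro d
  obtain ⟨i, k, hi, hk, rfl⟩ := h.surj d
  have : {e : D | M.vertexOf e = M.vertexOf (L i k)} = L i '' (Finset.range (2 * q) : Set ℕ) := by
    ext e
    simp only [Set.mem_ofPred_eq, Set.mem_image, Finset.coe_range, Set.mem_Iio]
    constructor
    · intro he
      obtain ⟨j, l, hj, hl, rfl⟩ := h.surj e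
      rw [h.vertexOf_eq_iff hq hN, Nat.mod_eq_of_lt hi, Nat.mod_eq_of_lt hj] at he
      exact ⟨l, hl, by rw [he]⟩
    · rintro ⟨l, hl, rfl⟩
      rw [h.vertexOf_eq_iff hq hN]
  rw [this, Set.InjOn.ncard_image, Set.ncard_coe_finset, Finset.card_range]
  intro k hk l hl e
  simp only [Finset.coe_range, Set.mem_Iio] at hk hl
  exact (h.inj _ _ _ _ hi hi hk hl e).2

theorem card_vertex (h : IsFrame M q N L) (hq : 0 < q) (hN : 0 < N) :
    Nat.card M.Vertex = 2 * N := by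
  have hb : Function.Bijective (fun i : Fin (2 * N) => M.vertexOf (L i 0)) := by
    constructor
    · intro i j e
      rw [h.vertexOf_eq_iff hq hN, Nat.mod_eq_of_lt i.2, Nat.mod_eq_of_lt j.2] at e
      exact Fin.ext e
    · intro c
      induction c using Quotient.inductionOn with | _ d => ?_
      obtain ⟨i, k, hi, hk, rfl⟩ := h.surj d
      exact ⟨⟨i, hi⟩, (h.vertexOf_eq i k).symm⟩
  rw [← Nat.card_congr (Equiv.ofBijective _ hb), Nat.card_fin]

theorem isHamiltonianCycle (h : IsFrame M q N L) (hq : 0 < q) (hN : 0 < N) :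
    M.IsHamiltonianCycle (gridCycle q L) := by
  have : NeZero (2 * N) := ⟨by omega⟩
  have hval (i : ZMod (2 * N)) : (i + 1).val = (i.val + 1) % (2 * N) := by
    rw [ZMod.val_add, ZMod.val_one_eq_one_mod, Nat.add_mod_mod]
  refine ⟨2 * N, by omega, fun i => L i.val 0, ⟨fun i j e => ?_, fun c => ?_⟩, fun i => ?_,
    fun i j e => ?_, ?_⟩
  · simp only [h.vertexOf_eq_iff hq hN, Nat.mod_eq_of_lt (ZMod.val_lt _)] at e
    exact ZMod.val_injective _ e
  · induction c using Quotient.inductionOn with | _ d => ?_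
    obtain ⟨i, k, hi, hk, rfl⟩ := h.surj d
    refine ⟨(i : ZMod (2 * N)), ?_⟩
    simp only [ZMod.val_natCast, Nat.mod_eq_of_lt hi]
    exact (h.vertexOf_eq i k).symm
  · rw [h.opp_eq, h.vertexOf_eq_iff hq hN, hval, Nat.mod_mod]
  · rw [h.opp_eq, h.eq_iff hq hN, Nat.zero_mod, Nat.mod_eq_of_lt (show q < 2 * q by omega)] at e
    omega
  · ext d
    constructor
    · rintro ⟨i, rfl | rfl⟩
      · refine ⟨(i : ZMod (2 * N)), Or.inl ?_⟩
        rw [h.eq_iff hq hN, ZMod.val_natCast, Nat.mod_mod]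
        exact ⟨rfl, rfl⟩
      -- The incoming dart at `i` is opposite to the outgoing dart at `i - 1`, written without
      -- subtraction of `1` from `i`.
      · refine ⟨((i + (2 * N - 1) : ℕ) : ZMod (2 * N)), Or.inr ?_⟩
        rw [h.opp_eq, h.eq_iff hq hN, ZMod.val_natCast, Nat.mod_add_mod, add_assoc,
          Nat.sub_add_cancel (by omega), Nat.add_mod_right]
        exact ⟨rfl, rfl⟩
    · rintro ⟨i, rfl | rfl⟩
      · exact ⟨i.val, Or.inl rfl⟩
      · exact ⟨i.val + 1, Or.inr (h.opp_eq _)⟩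

end IsFrame

/-! ### Planarity -/

section Planarity

variable {D : Type}

/-- The half-edges in `V` are joined as in `M`, the other ones are left alone. -/
def CombMap.oppOn (M : CombMap D) (V : Set D) [DecidablePred (· ∈ V)]
    (hV : ∀ d, M.opp d ∈ V ↔ d ∈ V) : Equiv.Perm D :=
  Function.Involutive.toPerm (fun d => if d ∈ V then M.opp d else d) fun d => by
    by_cases h : d ∈ V
    · simp [h, hV, M.opp_opp]
    · simp [h]

theorem CombMap.oppOn_apply (M : CombMap D) (V : Set D) [DecidablePred (· ∈ V)]
    (hV : ∀ d, M.opp d ∈ V ↔ d ∈ V) (d : D) :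
    M.oppOn V hV d = if d ∈ V then M.opp d else d := rfl

/-- `opp` is an involution without fixed points, so a dart amounts to an edge and a choice between
its chosen representative and the opposite of that. -/
theorem CombMap.two_mul_card_edge (M : CombMap D) : 2 * Nat.card M.Edge = Nat.card D := by
  have hpow : ∀ (n : ℤ) (d : D), (M.opp ^ n) d = d ∨ (M.opp ^ n) d = M.opp d := by
    intro n d
    have h2 : M.opp ^ (2 : ℤ) = 1 := by
      ext d
      rw [zpow_two, Equiv.Perm.mul_apply, M.opp_opp, Equiv.Perm.one_apply]
    rcases Int.even_or_odd' n with ⟨m, rfl | rfl⟩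
    · left
      rw [zpow_mul, h2, one_zpow, Equiv.Perm.one_apply]
    · right
      rw [zpow_add, zpow_mul, h2, one_zpow, one_mul, zpow_one]
  let g (x : M.Edge × Bool) : D := if x.2 then x.1.out else M.opp x.1.out
  have hopp (d : D) : (Quotient.mk _ (M.opp d) : M.Edge) = Quotient.mk _ d :=
    Quotient.sound (Equiv.Perm.SameCycle.symm ⟨1, by simp⟩)
  have hmk (x : M.Edge × Bool) : Quotient.mk _ (g x) = x.1 := by
    obtain ⟨c, b⟩ := x
    cases b
    · simp only [g, Bool.false_eq_true, if_false]
      rw [hopp, Quotient.out_eq]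
    · simp [g]
  have hg : Function.Bijective g := by
    constructor
    · intro x y e
      have h1 : x.1 = y.1 := by rw [← hmk x, ← hmk y, e]
      obtain ⟨c, b⟩ := x
      obtain ⟨c', b'⟩ := y
      obtain rfl : c = c' := h1
      have h2 := M.opp_ne c.out
      have h3 := h2.symm
      cases b <;> cases b' <;> simp_all [g]
    · intro d
      have h1 : Equiv.Perm.SameCycle M.opp (Quotient.mk _ d : M.Edge).out d :=
        Quotient.exact (Quotient.out_eq (Quotient.mk _ d : M.Edge))
      obtain ⟨n, hn⟩ := h1
      rcases hpow n (Quotient.mk _ d : M.Edge).out with h | h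
      · exact ⟨(Quotient.mk _ d, true), by simp only [g, if_true]; rw [← h, hn]⟩
      · refine ⟨(Quotient.mk _ d, false), ?_⟩
        simp only [g, Bool.false_eq_true, if_false]
        rw [← h, hn]
  rw [← Nat.card_congr (Equiv.ofBijective g hg), Nat.card_prod]
  simp [mul_comm]

end Planarity

/-! ### The walks along the two sides of the cycle -/

theorem Nat.eq_of_mod_eq_of_pos_of_le {a b n : ℕ} (h : a % n = b % n) (ha : 0 < a) (hb : 0 < b)
    (ha' : a ≤ n) (hb' : b ≤ n) : a = b := by
  refine Nat.ModEq.eq_of_abs_lt h ?_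
  rw [abs_lt]
  omega

/-- The darts on the right of the Hamiltonian cycle, including those of the cycle which go
forward. -/
def rightWalk {D : Type} (q : ℕ) (L : ℕ → ℕ → D) (t : ℕ) : D := L (t / q) (q + 1 + t % q)

/-- The darts on the left of the Hamiltonian cycle, including those of the cycle which go
backward. -/
def leftWalk {D : Type} (q N : ℕ) (L : ℕ → ℕ → D) (t : ℕ) : D :=
  -- Multiplication by `2 N - 1` is negation modulo `2 N`: the vertices are visited in the order `2
  -- N - 1, 2 N - 2, …`.
  L ((2 * N - 1) * (t / q + 1)) (1 + t % q)

section Walks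

variable {D : Type} {q N : ℕ} {L : ℕ → ℕ → D}

theorem rightWalk_eq (s r : ℕ) (hr : r < q) : rightWalk q L (q * s + r) = L s (q + 1 + r) := by
  rw [rightWalk, Nat.mul_add_div (by omega), Nat.div_eq_of_lt hr, Nat.mul_add_mod,
    Nat.mod_eq_of_lt hr, add_zero]

theorem leftWalk_eq (s r : ℕ) (hr : r < q) :
    leftWalk q N L (q * s + r) = L ((2 * N - 1) * (s + 1)) (1 + r) := by
  rw [leftWalk, Nat.mul_add_div (by omega), Nat.div_eq_of_lt hr, Nat.mul_add_mod,
    Nat.mod_eq_of_lt hr, add_zero]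

theorem IsDartGrid.leftWalk_eq (h : IsDartGrid q N L) (s r : ℕ) (hs : s < 2 * N) (hr : r < q) :
    leftWalk q N L (q * s + r) = L (2 * N - 1 - s) (1 + r) := by
  rw [_root_.leftWalk_eq s r hr, ← h.mod_eq, ← h.mod_eq (2 * N - 1 - s)]
  congr 1
  have : (2 * N - 1) * (s + 1) = 2 * N * s + (2 * N - 1 - s) := by
    zify [show 1 ≤ 2 * N by omega, show s ≤ 2 * N - 1 by omega]
    ring
  rw [this, Nat.mul_add_mod]

theorem exists_div_mod (q t : ℕ) (hq : 0 < q) : ∃ s r, r < q ∧ t = q * s + r :=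
  ⟨t / q, t % q, Nat.mod_lt _ hq, (Nat.div_add_mod t q).symm⟩

theorem rightDart_eq (x : HalfArch q N) :
    rightDart L x = rightWalk q L (q * (ofLex x).1 + (ofLex x).2) := by
  have := (ofLex x).2.2
  rw [rightWalk_eq _ _ (by omega), rightDart]

theorem IsDartGrid.leftDart_eq (h : IsDartGrid q N L) (x : HalfArch q N) :
    leftDart L x = leftWalk q N L (q * (2 * N - 1 - (ofLex x).1) + (q - 2 - (ofLex x).2)) := by
  have h1 := (ofLex x).2.2
  have h2 := (ofLex x).1.2
  rw [h.leftWalk_eq _ _ (by omega) (by omega), leftDart]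
  congr 1 <;> omega

theorem HalfArch.mul_add_lt {x : HalfArch q N} :
    q * (ofLex x).1 + (ofLex x).2 < q * (2 * N) := by
  have h1 := (ofLex x).2.2
  have : q * ((ofLex x).1 + 1) ≤ q * (2 * N) := Nat.mul_le_mul_left _ (ofLex x).1.2
  rw [Nat.mul_add] at this
  omega

theorem HalfArch.mul_add_lt' {x : HalfArch q N} :
    q * (2 * N - 1 - (ofLex x).1) + (q - 2 - (ofLex x).2) < q * (2 * N) := by
  have h1 := (ofLex x).2.2
  have h2 := (ofLex x).1.2
  have : q * (2 * N - 1 - (ofLex x).1 + 1) ≤ q * (2 * N) := Nat.mul_le_mul_left _ (by omega)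
  rw [Nat.mul_add] at this
  omega

theorem HalfArch.strictMono_mul_add :
    StrictMono (fun x : HalfArch q N => q * ((ofLex x).1 : ℕ) + (ofLex x).2) := by
  intro x y hxy
  have h1 := (ofLex x).2.2
  have h2 := (ofLex y).2.2
  simp only
  rcases Prod.Lex.lt_iff.1 hxy with h | ⟨h, h'⟩
  · have : q * ((ofLex x).1 + 1) ≤ q * (ofLex y).1 := Nat.mul_le_mul_left _ h
    rw [Nat.mul_add] at this
    omega
  · rw [h]
    have : ((ofLex x).2 : ℕ) < (ofLex y).2 := h'
    omega

theorem HalfArch.strictAnti_mul_add :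
    StrictAnti (fun x : HalfArch q N =>
      q * (2 * N - 1 - ((ofLex x).1 : ℕ)) + (q - 2 - (ofLex x).2)) := by
  intro x y hxy
  have h1 := (ofLex x).2.2
  have h2 := (ofLex y).2.2
  have h3 := (ofLex y).1.2
  simp only
  rcases Prod.Lex.lt_iff.1 hxy with h | ⟨h, h'⟩
  · have h4 : ((ofLex x).1 : ℕ) < (ofLex y).1 := h
    have : q * (2 * N - 1 - (ofLex y).1 + 1) ≤ q * (2 * N - 1 - (ofLex x).1) :=
      Nat.mul_le_mul_left _ (by omega)
    rw [Nat.mul_add] at this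
    omega
  · rw [h]
    have : ((ofLex x).2 : ℕ) < (ofLex y).2 := h'
    omega

end Walks

/-- The arches of the map `M` on the left of the Hamiltonian cycle are given by `f`, and those on
the right by `g`. -/
structure HasArches {D : Type} {q N : ℕ} (M : CombMap D) (L : ℕ → ℕ → D)
    (f g : HalfArch q N → HalfArch q N) : Prop where
  left : ∀ x, M.opp (leftDart L x) = leftDart L (f x)
  right : ∀ x, M.opp (rightDart L x) = rightDart L (g x)

namespace IsFrame

variable {D : Type} {q N : ℕ} {L : ℕ → ℕ → D} {M : CombMap D}

theorem opp_mem_gridCycle_iff (h : IsFrame M q N L) (hN : 0 < N) (d : D) :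
    M.opp d ∈ gridCycle q L ↔ d ∈ gridCycle q L := by
  refine ⟨fun hd => ?_, h.opp_mem_gridCycle hN⟩
  have := h.opp_mem_gridCycle hN hd
  rwa [M.opp_opp] at this

/-- When only the edges of the Hamiltonian cycle are crossed, the face permutation turns through the
darts on one side of a vertex and then passes along the cycle to the next vertex, still on the same
side. -/
theorem isTwoCycles (h : IsFrame M q N L) (hq : 0 < q) (hN : 0 < N)
    [DecidablePred (· ∈ gridCycle q L)] :
    IsTwoCycles (M.rot * M.oppOn (gridCycle q L) (h.opp_mem_gridCycle_iff hN)) (q * (2 * N))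
      (rightWalk q L) (leftWalk q N L) where
  succR t := by
    obtain ⟨s, r, hr, rfl⟩ := exists_div_mod q t hq
    rw [Equiv.Perm.mul_apply, CombMap.oppOn_apply, rightWalk_eq s r hr]
    by_cases hr' : r + 1 = q
    · have e1 : L s (q + 1 + r) = L s 0 := by
        rw [← h.dperiod s 0]; congr 1; omega
      have e2 : q * s + r + 1 = q * (s + 1) + 0 := by rw [Nat.mul_succ]; omega
      rw [e1, if_pos ⟨s, Or.inl rfl⟩, h.opp_eq, h.rot_eq, e2, rightWalk_eq _ _ hq]
    · rw [if_neg, h.rot_eq, add_assoc (q * s), rightWalk_eq _ _ (by omega), ← add_assoc]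
      rw [h.mem_gridCycle hq hN _ _ (by omega)]
      omega
  succS t := by
    obtain ⟨s, r, hr, rfl⟩ := exists_div_mod q t hq
    rw [Equiv.Perm.mul_apply, CombMap.oppOn_apply, _root_.leftWalk_eq s r hr]
    by_cases hr' : r + 1 = q
    · have e2 : q * s + r + 1 = q * (s + 1) + 0 := by rw [Nat.mul_succ]; omega
      rw [show 1 + r = q by omega, if_pos ⟨_, Or.inr rfl⟩, h.opp_eq_pred hN, h.rot_eq, e2,
        _root_.leftWalk_eq _ _ hq, Nat.mul_succ _ (s + 1), zero_add]
    · rw [if_neg, h.rot_eq, add_assoc (q * s), _root_.leftWalk_eq _ _ (by omega), add_assoc 1]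
      rw [h.mem_gridCycle hq hN _ _ (by omega)]
      omega
  periodR := by
    have h1 := rightWalk_eq (L := L) (2 * N) 0 hq
    have h2 := rightWalk_eq (L := L) 0 0 hq
    have h3 := h.vperiod 0 (q + 1 + 0)
    rw [zero_add] at h3
    rw [add_zero, h3] at h1
    rw [mul_zero, add_zero] at h2
    rw [h1, h2]
  periodS := by
    have h1 := _root_.leftWalk_eq (L := L) (N := N) (2 * N) 0 hq
    have h2 := _root_.leftWalk_eq (L := L) (N := N) 0 0 hq
    rw [add_zero] at h1
    rw [mul_zero, add_zero] at h2
    rw [h1, h2, h.eq_iff hq hN, mul_add, mul_comm _ (2 * N), Nat.mul_add_mod, zero_add]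
    exact ⟨rfl, rfl⟩
  injR s t hs ht e := by
    obtain ⟨s, r, hr, rfl⟩ := exists_div_mod q s hq
    obtain ⟨t, u, hu, rfl⟩ := exists_div_mod q t hq
    have hs' : s < 2 * N := Nat.lt_of_mul_lt_mul_left (a := q) (by omega)
    have ht' : t < 2 * N := Nat.lt_of_mul_lt_mul_left (a := q) (by omega)
    rw [rightWalk_eq _ _ hr, rightWalk_eq _ _ hu, h.eq_iff hq hN, Nat.mod_eq_of_lt hs',
      Nat.mod_eq_of_lt ht'] at e
    have := Nat.eq_of_mod_eq_of_pos_of_le e.2 (by omega) (by omega) (by omega) (by omega)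
    rw [e.1, show r = u by omega]
  injS s t hs ht e := by
    obtain ⟨s, r, hr, rfl⟩ := exists_div_mod q s hq
    obtain ⟨t, u, hu, rfl⟩ := exists_div_mod q t hq
    have hs' : s < 2 * N := Nat.lt_of_mul_lt_mul_left (a := q) (by omega)
    have ht' : t < 2 * N := Nat.lt_of_mul_lt_mul_left (a := q) (by omega)
    rw [h.leftWalk_eq _ _ hs' hr, h.leftWalk_eq _ _ ht' hu, h.eq_iff hq hN,
      Nat.mod_eq_of_lt (by omega), Nat.mod_eq_of_lt (by omega)] at e
    have := Nat.eq_of_mod_eq_of_pos_of_le e.2 (by omega) (by omega) (by omega) (by omega)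
    rw [show s = t by omega, show r = u by omega]
  disj s t hs ht e := by
    obtain ⟨s, r, hr, rfl⟩ := exists_div_mod q s hq
    obtain ⟨t, u, hu, rfl⟩ := exists_div_mod q t hq
    rw [rightWalk_eq _ _ hr, _root_.leftWalk_eq _ _ hu, h.eq_iff hq hN] at e
    have := Nat.eq_of_mod_eq_of_pos_of_le e.2 (by omega) (by omega) (by omega) (by omega)
    omega
  surj d := by
    have hlt : ∀ i r, i < 2 * N → r < q → q * i + r < q * (2 * N) := by
      intro i r hi hr
      have : q * (i + 1) ≤ q * (2 * N) := Nat.mul_le_mul_left _ hi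
      rw [Nat.mul_succ] at this
      omega
    obtain ⟨i, k, hi, hk, rfl⟩ := h.surj d
    rcases Nat.eq_zero_or_pos k with rfl | hk0
    · refine ⟨q * i + (q - 1), hlt _ _ hi (by omega), Or.inl ?_⟩
      rw [rightWalk_eq _ _ (by omega), ← h.dperiod]
      congr 1
      omega
    by_cases hkq : k ≤ q
    · refine ⟨q * (2 * N - 1 - i) + (k - 1), hlt _ _ (by omega) (by omega), Or.inr ?_⟩
      rw [h.leftWalk_eq _ _ (by omega) (by omega)]
      congr 1 <;> omega
    · refine ⟨q * i + (k - q - 1), hlt _ _ hi (by omega), Or.inl ?_⟩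
      rw [rightWalk_eq _ _ (by omega)]
      congr 1
      omega

theorem card_gridCycle (h : IsFrame M q N L) (hq : 0 < q) [DecidablePred (· ∈ gridCycle q L)]
    [Fintype D] (hN : 0 < N) :
    (Finset.univ.filter (· ∈ gridCycle q L)).card = 4 * N := by
  classical
  have e : Finset.univ.filter (· ∈ gridCycle q L) =
      ((Finset.range (2 * N) ×ˢ {0, q}).image fun x => L x.1 x.2) := by
    ext d
    simp only [Finset.mem_filter, Finset.mem_univ, true_and, Finset.mem_image, Finset.mem_product,
      Finset.mem_range, Finset.mem_insert, Finset.mem_singleton, Prod.exists]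
    constructor
    · intro hd
      obtain ⟨i, k, hi, hk, rfl⟩ := h.surj d
      rw [h.mem_gridCycle hq hN _ _ hk] at hd
      exact ⟨i, k, ⟨hi, hd⟩, rfl⟩
    · rintro ⟨i, k, ⟨-, rfl | rfl⟩, rfl⟩
      · exact ⟨i, Or.inl rfl⟩
      · exact ⟨i, Or.inr rfl⟩
  rw [e, Finset.card_image_of_injOn, Finset.card_product, Finset.card_range,
    Finset.card_pair (by omega)]
  · ring
  · rintro ⟨i, k⟩ hx ⟨j, l⟩ hy he
    simp only [Finset.coe_product, Set.mem_prod, Finset.coe_range, Set.mem_Iio, Finset.mem_coe,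
      Finset.mem_insert, Finset.mem_singleton] at hx hy
    obtain ⟨e1, e2⟩ := h.inj _ _ _ _ hx.1 hy.1 (by omega) (by omega) he
    exact Prod.ext e1 e2

end IsFrame

/-! ### Planarity as non-crossing of the arches -/

/-- The arches `f` are non-crossing. -/
def IsNoncrossing {q N : ℕ} (f : HalfArch q N → HalfArch q N) : Prop :=
  (∀ x, f (f x) = x) ∧ ∀ x y, ¬ (x < y ∧ y < f x ∧ f x < f y)

namespace IsFrame

variable {D : Type} {q N : ℕ} {L : ℕ → ℕ → D} {M : CombMap D} [Fintype D]

/-- Planarity in terms of the positions of the darts along both sides of the Hamiltonian cycle. -/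
theorem exists_pos_planar_iff (h : IsFrame M q N L) (hq : 0 < q) (hN : 0 < N) :
    ∃ pos : D → ℕ,
      (∀ x : HalfArch q N, pos (rightDart L x) = q * (ofLex x).1 + (ofLex x).2) ∧
      (∀ x : HalfArch q N, pos (leftDart L x) =
        q * (2 * N) + (q * (2 * N - 1 - (ofLex x).1) + (q - 2 - (ofLex x).2))) ∧
      (M.Planar ↔ (∀ d ∉ gridCycle q L, (pos d < q * (2 * N) ↔ pos (M.opp d) < q * (2 * N))) ∧
        ∀ d ∉ gridCycle q L, ∀ e ∉ gridCycle q L,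
          ¬ (pos d < pos e ∧ pos e < pos (M.opp d) ∧ pos (M.opp d) < pos (M.opp e))) := by
  classical
  obtain ⟨pos, hpos, hR, hS, hside, hcyc⟩ :=
    (h.isTwoCycles hq hN).exists_pos (Nat.mul_pos hq (by omega))
  refine ⟨pos, fun x => ?_, fun x => ?_, ?_⟩
  · rw [rightDart_eq, hR _ HalfArch.mul_add_lt]
  · rw [h.leftDart_eq, hS _ HalfArch.mul_add_lt']
  have hV := h.opp_mem_gridCycle_iff hN
  have hV' : ∀ d, M.opp d ∈ (gridCycle q L)ᶜ ↔ d ∈ (gridCycle q L)ᶜ := fun d => not_congr (hV d)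
  set ρ := M.rot * M.oppOn (gridCycle q L) hV with hρ
  set τ := M.oppOn (gridCycle q L)ᶜ hV' with hτ
  have happ : ∀ d, τ d = if d ∈ gridCycle q L then d else M.opp d := by
    intro d
    rw [hτ, CombMap.oppOn_apply]
    by_cases hd : d ∈ gridCycle q L <;> simp [hd]
  have hinv : ∀ d, τ (τ d) = d := fun d => by
    rw [happ, happ]
    by_cases hd : d ∈ gridCycle q L
    · simp [hd]
    · simp [hd, hV, M.opp_opp]
  have hprod : ρ * τ = M.rot * M.opp := by
    ext d
    rw [Equiv.Perm.mul_apply, happ, hρ, Equiv.Perm.mul_apply, CombMap.oppOn_apply]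
    by_cases hd : d ∈ gridCycle q L
    · simp [hd]
    · simp [hd, hV]
  have hsupp : τ.support.card + 4 * N = 4 * q * N := by
    have e : τ.support = Finset.univ.filter (fun d => ¬ d ∈ gridCycle q L) := by
      ext d
      rw [Equiv.Perm.mem_support, happ]
      by_cases hd : d ∈ gridCycle q L
      · simp [hd]
      · simp [hd, M.opp_ne]
    have h1 := Finset.card_filter_add_card_filter_not (s := (Finset.univ : Finset D))
      (fun d => d ∈ gridCycle q L)
    rw [h.card_gridCycle hq hN, ← e, Finset.card_univ, ← Nat.card_eq_fintype_card, h.card] at h1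
    omega
  have hiff := numCycles_mul_involution_eq_iff hpos hinv
  have hE := M.two_mul_card_edge
  have hVc := h.card_vertex hq hN
  -- There are `2 N` vertices and `2 q N` edges, and `τ` moves `4 q N - 4 N` darts. Euler's formula
  -- thus asks for `2` plus half this support as the number of faces, which is the maximum because
  -- `ρ` has two cycles.
  have hplanar : M.Planar ↔ 2 * numCycles (ρ * τ) = 2 * numCycles ρ + τ.support.card := by
    have hF : Nat.card M.Face = numCycles (ρ * τ) := by rw [hprod]; rfl
    rw [h.card] at hE
    simp only [CombMap.Planar, h.connected, true_and]
    omega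
  rw [hplanar, hiff]
  refine and_congr ⟨fun H d hd => ?_, fun H d => ?_⟩ ⟨fun H d hd e he => ?_, fun H d e => ?_⟩
  · have := H d
    rwa [hside, happ, if_neg hd] at this
  · rw [hside, happ]
    split_ifs with hd
    · rfl
    · exact H d hd
  · have := H d e
    rwa [happ, happ, if_neg hd, if_neg he] at this
  · rw [happ, happ]
    have := H d
    split_ifs with hd he he
    · omega
    · omega
    · omega
    · exact this hd e he

theorem exists_hasArches (h : IsFrame M q N L) (hq : 0 < q) (hN : 0 < N) (hM : M.Planar) :
    ∃ f g : HalfArch q N → HalfArch q N, HasArches M L f g ∧ IsNoncrossing f ∧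
      IsNoncrossing g := by
  obtain ⟨pos, hR, hL, hiff⟩ := h.exists_pos_planar_iff hq hN
  obtain ⟨hside, hnc⟩ := hiff.1 hM
  have hRlt : ∀ x : HalfArch q N, pos (rightDart L x) < q * (2 * N) := fun x => by
    rw [hR]; exact HalfArch.mul_add_lt
  have hLge : ∀ x : HalfArch q N, ¬ pos (leftDart L x) < q * (2 * N) := fun x => by
    rw [hL]; omega
  have hl : ∀ x : HalfArch q N, ∃ y : HalfArch q N, M.opp (leftDart L x) = leftDart L y := by
    intro x
    have hx := h.leftDart_notMem hN x
    have hx' := fun hd => hx ((h.opp_mem_gridCycle_iff hN _).1 hd)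
    have hs := hside _ hx
    rcases h.dart_cases (M.opp (leftDart L x)) with ⟨i, -, e⟩ | ⟨i, -, e⟩ | ⟨y, e⟩ | ⟨y, e⟩
    · exact absurd (e ▸ ⟨i, Or.inl rfl⟩) hx'
    · exact absurd (e ▸ ⟨i, Or.inr rfl⟩) hx'
    · exact ⟨y, e⟩
    · rw [e] at hs
      exact absurd (hs.2 (hRlt y)) (hLge x)
  have hr : ∀ x : HalfArch q N, ∃ y : HalfArch q N, M.opp (rightDart L x) = rightDart L y := by
    intro x
    have hx := h.rightDart_notMem hN x
    have hx' := fun hd => hx ((h.opp_mem_gridCycle_iff hN _).1 hd)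
    have hs := hside _ hx
    rcases h.dart_cases (M.opp (rightDart L x)) with ⟨i, -, e⟩ | ⟨i, -, e⟩ | ⟨y, e⟩ | ⟨y, e⟩
    · exact absurd (e ▸ ⟨i, Or.inl rfl⟩) hx'
    · exact absurd (e ▸ ⟨i, Or.inr rfl⟩) hx'
    · rw [e] at hs
      exact absurd (hs.1 (hRlt x)) (hLge y)
    · exact ⟨y, e⟩
  choose f hf using hl
  choose g hg using hr
  have hfi : ∀ x, f (f x) = x := fun x => h.leftDart_injective (by rw [← hf, ← hf, M.opp_opp])
  have hgi : ∀ x, g (g x) = x := fun x => h.rightDart_injective (by rw [← hg, ← hg, M.opp_opp])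
  refine ⟨f, g, ⟨hf, hg⟩, ⟨hfi, fun x y hxy => ?_⟩, hgi, fun x y hxy => ?_⟩
  -- Positions decrease from left to right on the left side, so a crossing `x < y < f x < f y` is
  -- read from its last point backward.
  · have := hnc _ (h.leftDart_notMem hN (f y)) _ (h.leftDart_notMem hN (f x))
    rw [hf, hf, hfi, hfi, hL, hL, hL, hL] at this
    exact this ⟨Nat.add_lt_add_left (HalfArch.strictAnti_mul_add hxy.2.2) _,
      Nat.add_lt_add_left (HalfArch.strictAnti_mul_add hxy.2.1) _,
      Nat.add_lt_add_left (HalfArch.strictAnti_mul_add hxy.1) _⟩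
  · have := hnc _ (h.rightDart_notMem hN x) _ (h.rightDart_notMem hN y)
    rw [hg, hg, hR, hR, hR, hR] at this
    exact this ⟨HalfArch.strictMono_mul_add hxy.1, HalfArch.strictMono_mul_add hxy.2.1,
      HalfArch.strictMono_mul_add hxy.2.2⟩

theorem planar_of_hasArches (h : IsFrame M q N L) (hq : 0 < q) (hN : 0 < N)
    {f g : HalfArch q N → HalfArch q N} (ha : HasArches M L f g) (hf : IsNoncrossing f)
    (hg : IsNoncrossing g) : M.Planar := by
  obtain ⟨pos, hR, hL, hiff⟩ := h.exists_pos_planar_iff hq hN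
  have hRlt : ∀ x : HalfArch q N, pos (rightDart L x) < q * (2 * N) := fun x => by
    rw [hR]; exact HalfArch.mul_add_lt
  have hLge : ∀ x : HalfArch q N, ¬ pos (leftDart L x) < q * (2 * N) := fun x => by
    rw [hL]; omega
  have hRR : ∀ x y : HalfArch q N, pos (rightDart L x) < pos (rightDart L y) → x < y := by
    intro x y hxy
    rw [hR, hR] at hxy
    exact HalfArch.strictMono_mul_add.lt_iff_lt.1 hxy
  have hLL : ∀ x y : HalfArch q N, pos (leftDart L x) < pos (leftDart L y) → y < x := by
    intro x y hxy
    rw [hL, hL] at hxy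
    exact HalfArch.strictAnti_mul_add.lt_iff_gt.1 (Nat.lt_of_add_lt_add_left hxy)
  have hcases : ∀ d ∉ gridCycle q L, (∃ x : HalfArch q N, d = leftDart L x) ∨
      ∃ x : HalfArch q N, d = rightDart L x := by
    intro d hd
    rcases h.dart_cases d with ⟨i, -, e⟩ | ⟨i, -, e⟩ | e | e
    · exact absurd (e ▸ ⟨i, Or.inl rfl⟩) hd
    · exact absurd (e ▸ ⟨i, Or.inr rfl⟩) hd
    · exact Or.inl e
    · exact Or.inr e
  refine hiff.2 ⟨fun d hd => ?_, fun d hd e he => ?_⟩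
  · rcases hcases d hd with ⟨x, rfl⟩ | ⟨x, rfl⟩
    · rw [ha.left]
      exact iff_of_false (hLge _) (hLge _)
    · rw [ha.right]
      exact iff_of_true (hRlt _) (hRlt _)
  · rintro ⟨h1, h2, h3⟩
    rcases hcases d hd with ⟨x, rfl⟩ | ⟨x, rfl⟩ <;> rcases hcases e he with ⟨y, rfl⟩ | ⟨y, rfl⟩
    · rw [ha.left] at h2 h3
      rw [ha.left] at h3
      refine hf.2 (f y) (f x) ⟨hLL _ _ h3, ?_, ?_⟩
      · rw [hf.1]
        exact hLL _ _ h2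
      · rw [hf.1, hf.1]
        exact hLL _ _ h1
    · have := hLge x
      have := hRlt y
      omega
    · rw [ha.right] at h2
      have := hLge y
      have := hRlt (g x)
      omega
    · rw [ha.right] at h2 h3
      rw [ha.right] at h3
      exact hg.2 x y ⟨hRR _ _ h1, hRR _ _ h2, hRR _ _ h3⟩

end IsFrame

/-! ### The frame of a rigid Hamiltonian cycle -/

theorem perm_apply_inv {D : Type} (π : Equiv.Perm D) (d : D) : π (π⁻¹ d) = d :=
  Equiv.apply_symm_apply π d

theorem perm_inv_apply {D : Type} (π : Equiv.Perm D) (d : D) : π⁻¹ (π d) = d :=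
  Equiv.symm_apply_apply π d

/-- The darts of `M`, numbered along a rigid Hamiltonian cycle which begins with the dart `m`. -/
def CombMap.grid {D : Type} (M : CombMap D) (q : ℕ) (m : D) (i k : ℕ) : D :=
  -- Crossing the outgoing edge leads to the incoming dart of the next vertex, which is `q` turns
  -- after the outgoing one there.
  (M.rot ^ k) ((((M.rot ^ q)⁻¹ * M.opp) ^ i) m)

/-- The darts at a vertex form one orbit of `rot`, so the valency is the minimal period. -/
theorem CombMap.Regular.exists_pow {D : Type} [Fintype D] {M : CombMap D} {n : ℕ}
    (h : M.Regular n) (d : D) :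
    (M.rot ^ n) d = d ∧ (∀ k l, k < n → l < n → (M.rot ^ k) d = (M.rot ^ l) d → k = l) ∧
      ∀ e, M.vertexOf e = M.vertexOf d → ∃ k < n, e = (M.rot ^ k) d := by
  classical
  have hper : d ∈ Function.periodicPts M.rot :=
    Function.Injective.mem_periodicPts M.rot.injective d
  set m := Function.minimalPeriod M.rot d with hm
  have hm0 : 0 < m := Function.minimalPeriod_pos_of_mem_periodicPts hper
  have hmd : (M.rot ^ m) d = d := by
    rw [Equiv.Perm.coe_pow]
    exact Function.isPeriodicPt_minimalPeriod M.rot d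
  have hinj : Set.InjOn (fun k => (M.rot ^ k) d) (Finset.range m : Set ℕ) := by
    intro k hk l hl e
    simp only [Equiv.Perm.coe_pow] at e
    simp only [Finset.coe_range] at hk hl
    exact Function.iterate_injOn_Iio_minimalPeriod hk hl e
  have hex : ∀ e, M.vertexOf e = M.vertexOf d → ∃ k < m, e = (M.rot ^ k) d := by
    intro e he
    have hs : Equiv.Perm.SameCycle M.rot d e := (Quotient.exact he).symm
    obtain ⟨k, -, -, rfl⟩ := hs.exists_pow_eq M.rot
    refine ⟨k % m, Nat.mod_lt _ hm0, ?_⟩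
    rw [Equiv.Perm.coe_pow, Equiv.Perm.coe_pow, hm, Function.iterate_mod_minimalPeriod_eq]
  have hset : {e : D | M.vertexOf e = M.vertexOf d} =
      (fun k => (M.rot ^ k) d) '' (Finset.range m : Set ℕ) := by
    ext e
    simp only [Set.mem_ofPred_eq, Set.mem_image, Finset.coe_range, Set.mem_Iio]
    constructor
    · intro he
      obtain ⟨k, hk, rfl⟩ := hex e he
      exact ⟨k, hk, rfl⟩
    · rintro ⟨k, -, rfl⟩
      exact Quotient.sound (Equiv.Perm.SameCycle.symm ⟨(k : ℤ), by rw [zpow_natCast]⟩)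
  have hmn : m = n := by
    rw [← h d, hset, Set.InjOn.ncard_image hinj, Set.ncard_coe_finset, Finset.card_range]
  rw [← hmn]
  refine ⟨hmd, fun k l hk hl e => ?_, hex⟩
  exact hinj (by simpa using hk) (by simpa using hl) e

/-- A Hamiltonian cycle can be run through from each of its darts. -/
theorem CombMap.IsHamiltonianCycle.exists_start {D : Type} {M : CombMap D}
    {H : Set D} (h : M.IsHamiltonianCycle H) {m : D} (hm : m ∈ H) :
    ∃ n : ℕ, 0 < n ∧ ∃ p : ZMod n → D, p 0 = m ∧
      Function.Bijective (fun i => M.vertexOf (p i)) ∧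
      (∀ i, M.vertexOf (M.opp (p i)) = M.vertexOf (p (i + 1))) ∧
      (∀ i j, p i ≠ M.opp (p j)) ∧ H = {d | ∃ i, d = p i ∨ d = M.opp (p i)} := by
  obtain ⟨n, hn, p, hbij, hstep, hne, rfl⟩ := h
  obtain ⟨i, rfl | rfl⟩ := hm
  · refine ⟨n, hn, fun j => p (j + i), by simp, ?_, fun j => ?_, fun j k => hne _ _, ?_⟩
    · exact hbij.comp (Equiv.addRight i).bijective
    · rw [hstep]
      congr 2
      ring
    · ext d
      constructor
      · rintro ⟨j, hj⟩
        exact ⟨j - i, by simpa using hj⟩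
      · rintro ⟨j, hj⟩
        exact ⟨j + i, hj⟩
  -- Here the prescribed dart points backward, so the cycle is traversed in the opposite direction.
  · refine ⟨n, hn, fun j => M.opp (p (i - j)), by simp, ?_, fun j => ?_, fun j k e => ?_, ?_⟩
    · have e : (fun j => M.vertexOf (M.opp (p (i - j)))) =
          (fun j => M.vertexOf (p j)) ∘ (Equiv.subLeft (i + 1)) := by
        funext j
        rw [hstep, Function.comp, Equiv.subLeft_apply]
        congr 2
        ring
      rw [e]
      exact hbij.comp (Equiv.subLeft (i + 1)).bijective
    · rw [M.opp_opp, hstep]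
      congr 2
      ring
    · rw [M.opp_opp] at e
      exact hne _ _ e.symm
    · ext d
      simp only [M.opp_opp]
      constructor
      · rintro ⟨j, hj⟩
        exact ⟨i - j, by simpa using hj.symm⟩
      · rintro ⟨j, hj⟩
        exact ⟨i - j, hj.symm⟩

namespace RigidConfig

variable {q N : ℕ} {D : Type}

/-- The darts of a configuration, numbered along its Hamiltonian cycle from the marked edge. -/
def grid (A : RigidConfig q N D) : ℕ → ℕ → D := A.map.grid q A.marked

theorem exists_frame [Fintype D] (A : RigidConfig q N D) (hq : 0 < q) :
    IsFrame A.map q N A.grid ∧ A.visited = gridCycle q A.grid := by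
  obtain ⟨n, hn, p, hp0, hbij, hstep, hne, hH⟩ := A.hamiltonian.exists_start A.marked_visited
  have : NeZero n := ⟨hn.ne'⟩
  obtain rfl : n = 2 * N := by
    rw [← A.card_vertex, ← Nat.card_congr (Equiv.ofBijective _ hbij), Nat.card_zmod]
  set M := A.map with hM
  have hreg := fun d => A.regular.exists_pow d
  have hpH : ∀ i, p i ∈ A.visited := fun i => hH ▸ ⟨i, Or.inl rfl⟩
  -- The arriving dart is visited and is some `rot ^ k` of the outgoing one with `k < 2 q`. The
  -- value `k = 0` would use an edge twice, and rigidity, applied at the outgoing dart and again `q`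
  -- turns later, excludes all others but `k = q`.
  have hopp : ∀ i, M.opp (p i) = (M.rot ^ q) (p (i + 1)) := by
    intro i
    obtain ⟨k, hk, e⟩ := (hreg (p (i + 1))).2.2 _ (hstep i)
    have hv : (M.rot ^ k) (p (i + 1)) ∈ A.visited := e ▸ hH ▸ ⟨i, Or.inr rfl⟩
    obtain ⟨r1, r2⟩ := A.rigid _ (hpH (i + 1))
    obtain ⟨r3, -⟩ := A.rigid _ r2
    rcases Nat.eq_zero_or_pos k with rfl | hk0
    · exact absurd e.symm (hne _ _)
    rcases lt_trichotomy k q with hkq | rfl | hkq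
    · exact absurd hv (r1 k hk0 hkq)
    · exact e
    · have := r3 (k - q) (by omega) (by omega)
      rw [← hM, ← Equiv.Perm.mul_apply, ← pow_add, Nat.sub_add_cancel hkq.le] at this
      exact absurd hv this
  have hL : A.grid = fun (i : ℕ) k => (M.rot ^ k) (p i) := by
    funext i k
    rw [grid, CombMap.grid]
    congr 1
    induction i with
    | zero => simpa using hp0.symm
    | succ i ih =>
      rw [pow_succ', Equiv.Perm.mul_apply, ih, Equiv.Perm.mul_apply, hopp, perm_inv_apply]
      push_cast
      rfl
  rw [hL]
  refine ⟨⟨⟨fun i k => ?_, fun i k => ?_, fun i j k l hi hj hk hl e => ?_, fun d => ?_⟩,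
    fun i k => ?_, fun i => ?_⟩, ?_⟩
  · have : ((i + 2 * N : ℕ) : ZMod (2 * N)) = i := by
      rw [Nat.cast_add, ZMod.natCast_self, add_zero]
    simp only [this]
  · rw [pow_add, Equiv.Perm.mul_apply, (hreg _).1]
  · have hv : ∀ (i k : ℕ), M.vertexOf ((M.rot ^ k) (p i)) = M.vertexOf (p i) := fun i k =>
      Quotient.sound (Equiv.Perm.SameCycle.symm ⟨(k : ℤ), by rw [zpow_natCast]⟩)
    have e1 : (i : ZMod (2 * N)) = j := by
      apply hbij.1
      simp only
      rw [← hv i k, ← hv j l]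
      exact congrArg _ e
    have e2 : i = j := by
      rw [← ZMod.val_cast_of_lt hi, ← ZMod.val_cast_of_lt hj, e1]
    subst e2
    exact ⟨rfl, (hreg _).2.1 _ _ hk hl e⟩
  · obtain ⟨i, hi⟩ := hbij.2 (M.vertexOf d)
    obtain ⟨k, hk, e⟩ := (hreg (p i)).2.2 d hi.symm
    exact ⟨i.val, k, ZMod.val_lt i, hk, by simpa using e⟩
  · rw [pow_succ', Equiv.Perm.mul_apply]
  · simp only [pow_zero, Equiv.Perm.one_apply, Nat.cast_add, Nat.cast_one]
    exact hopp i
  · rw [hH]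
    ext d
    constructor
    · rintro ⟨i, rfl | rfl⟩
      · exact ⟨i.val, Or.inl (by simp)⟩
      · exact ⟨i.val + 1, Or.inr (by simp [hopp])⟩
    · rintro ⟨i, rfl | rfl⟩
      · exact ⟨i, Or.inl rfl⟩
      · exact ⟨i - 1, Or.inr (by simp [hopp])⟩

theorem black_rot_pow (A : RigidConfig q N D) (k : ℕ) (d : D) :
    A.black ((A.map.rot ^ k) d) = A.black d := by
  induction k with
  | zero => rfl
  | succ k ih => rw [pow_succ', Equiv.Perm.mul_apply, A.bicolored.1, ih]

/-- Colors alternate along the cycle from the black marked vertex, so the coloring carries no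
information beyond the numbering. -/
theorem black_grid (A : RigidConfig q N D) (i k : ℕ) :
    A.black (A.grid i k) = decide (Even i) := by
  rw [grid, CombMap.grid, black_rot_pow]
  induction i with
  | zero => simpa using A.marked_black
  | succ i ih =>
    rw [pow_succ', Equiv.Perm.mul_apply, Equiv.Perm.mul_apply]
    set d := (((A.map.rot ^ q)⁻¹ * A.map.opp) ^ i) A.marked
    have h := A.black_rot_pow q ((A.map.rot ^ q)⁻¹ (A.map.opp d))
    rw [perm_apply_inv, A.bicolored.2, ih] at h
    rw [← h]
    simp only [Nat.even_add_one, decide_not]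

theorem grid_zero (A : RigidConfig q N D) : A.grid 0 0 = A.marked := rfl

/-- The arches of a configuration form two arch systems. -/
theorem exists_archSystems [Fintype D] (A : RigidConfig q N D) (hq : 0 < q) (hN : 0 < N) :
    ∃ f g : HalfArch q N → HalfArch q N, HasArches A.map A.grid f g ∧ IsArchSystem f ∧
      IsArchSystem g := by
  obtain ⟨f, g, h, hf, hg⟩ := (A.exists_frame hq).1.exists_hasArches hq hN A.planar
  have hc (x y : HalfArch q N) (hxy : decide (Even ((ofLex y).1 : ℕ)) =
      !decide (Even ((ofLex x).1 : ℕ))) : y.black ↔ ¬ x.black := by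
    unfold HalfArch.black
    by_cases h1 : Even ((ofLex x).1 : ℕ) <;> by_cases h2 : Even ((ofLex y).1 : ℕ) <;>
      simp_all
  refine ⟨f, g, h, ⟨hf.1, fun x => hc x _ ?_, hf.2⟩, ⟨hg.1, fun x => hc x _ ?_, hg.2⟩⟩
  · have := A.bicolored.2 (leftDart A.grid x)
    rw [h.left, leftDart, leftDart, black_grid, black_grid] at this
    exact this
  · have := A.bicolored.2 (rightDart A.grid x)
    rw [h.right, rightDart, rightDart, black_grid, black_grid] at this
    exact this

theorem Iso.grid_eq {E : Type} {A : RigidConfig q N D} {B : RigidConfig q N E} {e : D ≃ E}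
    (h1 : ∀ d, e (A.map.rot d) = B.map.rot (e d)) (h2 : ∀ d, e (A.map.opp d) = B.map.opp (e d))
    (h3 : e A.marked = B.marked) (i k : ℕ) : e (A.grid i k) = B.grid i k := by
  have hrot : ∀ (k : ℕ) (d : D), e ((A.map.rot ^ k) d) = (B.map.rot ^ k) (e d) := by
    intro k d
    induction k with
    | zero => rfl
    | succ k ih => rw [pow_succ', Equiv.Perm.mul_apply, h1, ih, pow_succ', Equiv.Perm.mul_apply]
  rw [grid, grid, CombMap.grid, CombMap.grid, hrot]
  congr 1
  induction i with
  | zero => exact h3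
  | succ i ih =>
    rw [pow_succ', pow_succ', Equiv.Perm.mul_apply, Equiv.Perm.mul_apply, Equiv.Perm.mul_apply,
      Equiv.Perm.mul_apply, ← ih, ← h2, Equiv.Perm.eq_inv_iff_eq, ← hrot, perm_apply_inv]

/-- Isomorphic configurations have the same arches. -/
theorem Iso.hasArches {E : Type} {A : RigidConfig q N D} {B : RigidConfig q N E} (h : A.Iso B)
    {f g : HalfArch q N → HalfArch q N} (ha : HasArches A.map A.grid f g) :
    HasArches B.map B.grid f g := by
  obtain ⟨e, h1, h2, -, -, h5⟩ := h
  have hgrid := Iso.grid_eq h1 h2 h5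
  have hl (x : HalfArch q N) : e (leftDart A.grid x) = leftDart B.grid x := hgrid _ _
  have hr (x : HalfArch q N) : e (rightDart A.grid x) = rightDart B.grid x := hgrid _ _
  refine ⟨fun x => ?_, fun x => ?_⟩
  · rw [← hl, ← h2, ha.left, hl]
  · rw [← hr, ← h2, ha.right, hr]

theorem hasArches_unique [Fintype D] (A : RigidConfig q N D) (hq : 0 < q)
    {f g f' g' : HalfArch q N → HalfArch q N} (h : HasArches A.map A.grid f g)
    (h' : HasArches A.map A.grid f' g') : f = f' ∧ g = g' := by
  have hF := (A.exists_frame hq).1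
  constructor
  · funext x
    exact hF.leftDart_injective (by rw [← h.left, ← h'.left])
  · funext x
    exact hF.rightDart_injective (by rw [← h.right, ← h'.right])

/-- Configurations with the same arches are isomorphic. -/
theorem iso_of_hasArches {E : Type} [Fintype D] [Fintype E] (A : RigidConfig q N D)
    (B : RigidConfig q N E) (hq : 0 < q) (hN : 0 < N) {f g : HalfArch q N → HalfArch q N}
    (hA : HasArches A.map A.grid f g) (hB : HasArches B.map B.grid f g) : A.Iso B := by
  obtain ⟨hFA, hVA⟩ := A.exists_frame hq
  obtain ⟨hFB, hVB⟩ := B.exists_frame hq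
  set e : D ≃ E := hFA.equiv.symm.trans hFB.equiv with he
  have hgrid : ∀ i k, e (A.grid i k) = B.grid i k := by
    intro i k
    have hi : i % (2 * N) < 2 * N := Nat.mod_lt _ (by omega)
    have hk : k % (2 * q) < 2 * q := Nat.mod_lt _ (by omega)
    have h1 : A.grid i k = hFA.equiv (⟨_, hi⟩, ⟨_, hk⟩) := by
      rw [hFA.equiv_apply, hFA.mod_eq]
    rw [h1, he, Equiv.trans_apply, Equiv.symm_apply_apply, hFB.equiv_apply, hFB.mod_eq]
  have hl (x : HalfArch q N) : e (leftDart A.grid x) = leftDart B.grid x := hgrid _ _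
  have hr (x : HalfArch q N) : e (rightDart A.grid x) = rightDart B.grid x := hgrid _ _
  refine ⟨e, fun d => ?_, fun d => ?_, fun d => ?_, fun d => ?_, ?_⟩
  · obtain ⟨i, k, -, -, rfl⟩ := hFA.surj d
    rw [hFA.rot_eq, hgrid, hgrid, hFB.rot_eq]
  · rcases hFA.dart_cases d with ⟨i, -, rfl⟩ | ⟨i, -, rfl⟩ | ⟨x, rfl⟩ | ⟨x, rfl⟩
    · rw [hFA.opp_eq, hgrid, hgrid, hFB.opp_eq]
    · rw [hFA.opp_eq_pred hN, hgrid, hgrid, hFB.opp_eq_pred hN]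
    · rw [hA.left, hl, hl, hB.left]
    · rw [hA.right, hr, hr, hB.right]
  · obtain ⟨i, k, -, -, rfl⟩ := hFA.surj d
    rw [hgrid, black_grid, black_grid]
  · obtain ⟨i, k, -, hk, rfl⟩ := hFA.surj d
    rw [hgrid, hVA, hVB, hFA.mem_gridCycle hq hN _ _ hk, hFB.mem_gridCycle hq hN _ _ hk]
  · rw [← grid_zero, hgrid, grid_zero]

end RigidConfig

/-! ### Construction of configurations from arch systems -/

/-- A frame can be recovered from the map and its initial dart, so the arches prescribed in a
construction are those read off from the configuration. -/
theorem IsFrame.grid_eq {D : Type} {q N : ℕ} {L : ℕ → ℕ → D} {M : CombMap D}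
    (h : IsFrame M q N L) : M.grid q (L 0 0) = L := by
  funext i k
  have h0 : (((M.rot ^ q)⁻¹ * M.opp) ^ i) (L 0 0) = L i 0 := by
    induction i with
    | zero => rfl
    | succ i ih =>
      rw [pow_succ', Equiv.Perm.mul_apply, ih, Equiv.Perm.mul_apply, h.opp_eq,
        Equiv.Perm.inv_eq_iff_eq, h.rot_pow, zero_add]
  rw [CombMap.grid, h0, h.rot_pow, zero_add]

theorem isDartGrid_of_equiv {D : Type} {q N : ℕ} (hq : 0 < q) (hN : 0 < N)
    (e : ZMod (2 * N) × ZMod (2 * q) ≃ D) : IsDartGrid q N fun i k => e (i, k) where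
  vperiod i k := by rw [Nat.cast_add, ZMod.natCast_self, add_zero]
  dperiod i k := by rw [Nat.cast_add, ZMod.natCast_self, add_zero]
  inj i j k l hi hj hk hl h := by
    have h' := e.injective h
    rw [Prod.mk.injEq] at h'
    rw [← ZMod.val_cast_of_lt hi, ← ZMod.val_cast_of_lt hj, ← ZMod.val_cast_of_lt hk,
      ← ZMod.val_cast_of_lt hl, h'.1, h'.2]
    exact ⟨rfl, rfl⟩
  surj d := by
    have : NeZero (2 * N) := ⟨by omega⟩
    have : NeZero (2 * q) := ⟨by omega⟩
    refine ⟨(e.symm d).1.val, (e.symm d).2.val, ZMod.val_lt _, ZMod.val_lt _, ?_⟩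
    simp

/-- There is a map with a given frame and given arches. -/
theorem exists_isFrame_hasArches {D : Type} {q N : ℕ} {L : ℕ → ℕ → D} (hL : IsDartGrid q N L)
    (hq : 0 < q) (hN : 0 < N) (rot : Equiv.Perm D) (hrot : ∀ i k, rot (L i k) = L i (k + 1))
    {f g : HalfArch q N → HalfArch q N} (hf : ∀ x, f (f x) = x) (hf' : ∀ x, f x ≠ x)
    (hg : ∀ x, g (g x) = x) (hg' : ∀ x, g x ≠ x) :
    ∃ M : CombMap D, IsFrame M q N L ∧ HasArches M L f g := by
  have : NeZero (2 * N) := ⟨by omega⟩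
  let F : (ZMod (2 * N) ⊕ ZMod (2 * N)) ⊕ (HalfArch q N ⊕ HalfArch q N) → D :=
    Sum.elim (Sum.elim (fun i => L i.val 0) (fun i => L i.val q))
      (Sum.elim (leftDart L) (rightDart L))
  have hF : Function.Bijective F := by
    constructor
    · refine Function.Injective.sumElim (Function.Injective.sumElim ?_ ?_ ?_)
        (Function.Injective.sumElim hL.leftDart_injective hL.rightDart_injective
          hL.leftDart_ne_rightDart) ?_
      · intro i j e
        exact ZMod.val_injective _
          (hL.inj _ _ _ _ (ZMod.val_lt i) (ZMod.val_lt j) (by omega) (by omega) e).1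
      · intro i j e
        exact ZMod.val_injective _
          (hL.inj _ _ _ _ (ZMod.val_lt i) (ZMod.val_lt j) (by omega) (by omega) e).1
      · intro i j e
        have := (hL.inj _ _ _ _ (ZMod.val_lt i) (ZMod.val_lt j) (by omega) (by omega) e).2
        omega
      · rintro (i | i) (x | x) e
        · exact hL.leftDart_notMem hN x ⟨_, Or.inl e.symm⟩
        · exact hL.rightDart_notMem hN x ⟨_, Or.inl e.symm⟩
        · exact hL.leftDart_notMem hN x ⟨_, Or.inr e.symm⟩
        · exact hL.rightDart_notMem hN x ⟨_, Or.inr e.symm⟩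
    · intro d
      rcases hL.dart_cases d with ⟨i, hi, rfl⟩ | ⟨i, hi, rfl⟩ | ⟨x, rfl⟩ | ⟨x, rfl⟩
      · exact ⟨Sum.inl (Sum.inl i), by simp only [F, Sum.elim_inl, ZMod.val_cast_of_lt hi]⟩
      · exact ⟨Sum.inl (Sum.inr i), by
          simp only [F, Sum.elim_inl, Sum.elim_inr, ZMod.val_cast_of_lt hi]⟩
      · exact ⟨Sum.inr (Sum.inl x), rfl⟩
      · exact ⟨Sum.inr (Sum.inr x), rfl⟩
  -- The opposite map in coordinates: the outgoing dart of `i` is joined to the incoming dart of `i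
  -- + 1`, and the half-arches are joined by `f` and `g`.
  let φ : (ZMod (2 * N) ⊕ ZMod (2 * N)) ⊕ (HalfArch q N ⊕ HalfArch q N) →
      (ZMod (2 * N) ⊕ ZMod (2 * N)) ⊕ (HalfArch q N ⊕ HalfArch q N) :=
    Sum.map (Sum.elim (fun i => Sum.inr (i + 1)) (fun i => Sum.inl (i - 1))) (Sum.map f g)
  have hφ : ∀ s, φ (φ s) = s := by
    rintro ((i | i) | (x | x)) <;> simp [φ, hf, hg]
  have hφ' : ∀ s, φ s ≠ s := by
    rintro ((i | i) | (x | x)) <;> simp [φ, hf', hg']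
  let E := Equiv.ofBijective F hF
  have hE : ∀ s, E.symm (F s) = s := fun s => Equiv.ofBijective_symm_apply_apply F hF s
  have hE' : ∀ d, F (E.symm d) = d := fun d => Equiv.ofBijective_apply_symm_apply F hF d
  let opp : Equiv.Perm D := Function.Involutive.toPerm (fun d => F (φ (E.symm d)))
    fun d => by simp only [hE, hφ, hE']
  have hopp : ∀ s, opp (F s) = F (φ s) := fun s => congrArg (fun t => F (φ t)) (hE s)
  refine ⟨⟨rot, opp, fun d => ?_, fun d h => ?_⟩, ⟨hL, hrot, fun i => ?_⟩, fun x => ?_, fun x => ?_⟩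
  · rw [← hE' d, hopp, hopp, hφ]
  · rw [← hE' d, hopp] at h
    exact hφ' _ (hF.1 h)
  · have h := hopp (Sum.inl (Sum.inl (i : ZMod (2 * N))))
    simp only [F, φ, Sum.map_inl, Sum.elim_inl, Sum.elim_inr] at h
    rw [← Nat.cast_one, ← Nat.cast_add, ZMod.val_natCast, ZMod.val_natCast] at h
    rw [(hL.eq_iff hq hN (i % (2 * N)) i 0 0).2 ⟨Nat.mod_mod _ _, rfl⟩,
      (hL.eq_iff hq hN ((i + 1) % (2 * N)) (i + 1) q q).2 ⟨Nat.mod_mod _ _, rfl⟩] at h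
    exact h
  · exact hopp (Sum.inr (Sum.inl x))
  · exact hopp (Sum.inr (Sum.inr x))

theorem IsArchSystem.apply_ne {q N : ℕ} {f : HalfArch q N → HalfArch q N} (hf : IsArchSystem f)
    (x : HalfArch q N) : f x ≠ x := fun h => by
  have := hf.2.1 x
  rw [h] at this
  tauto

/-- Any two arch systems can be put on the two sides of a standard cycle. Neither constrains the
other, which gives surjectivity of the correspondence. -/
theorem exists_rigidConfig {q N : ℕ} (hq : 0 < q) (hN : 0 < N)
    {f g : HalfArch q N → HalfArch q N} (hf : IsArchSystem f) (hg : IsArchSystem g) :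
    ∃ n, ∃ A : RigidConfig q N (Fin n), HasArches A.map A.grid f g := by
  have : NeZero (2 * N) := ⟨by omega⟩
  have : NeZero (2 * q) := ⟨by omega⟩
  let e := Fintype.equivFin (ZMod (2 * N) × ZMod (2 * q))
  set L : ℕ → ℕ → Fin (Fintype.card (ZMod (2 * N) × ZMod (2 * q))) := fun i k => e (i, k) with hLdef
  have hL : IsDartGrid q N L := isDartGrid_of_equiv hq hN e
  obtain ⟨M, hM, ha⟩ := exists_isFrame_hasArches hL hq hN
    ((e.symm.trans (Equiv.prodCongr (Equiv.refl _) (Equiv.addRight 1))).trans e)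
    (fun i k => by simp [hLdef]) hf.1 hf.apply_ne hg.1 hg.apply_ne
  let black (d : Fin (Fintype.card (ZMod (2 * N) × ZMod (2 * q)))) : Bool :=
    decide (Even (e.symm d).1.val)
  have hblack : ∀ i k, black (L i k) = decide (Even i) := by
    intro i k
    simp only [black, hLdef, Equiv.symm_apply_apply, ZMod.val_natCast, decide_eq_decide]
    -- The cycle has even length `2 N`, so the parity of `i` is well defined around it.
    rw [Nat.even_iff, Nat.even_iff, Nat.mod_mul_right_mod]
  have hcol : ∀ x y : HalfArch q N, (y.black ↔ ¬ x.black) →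
      decide (Even ((ofLex y).1 : ℕ)) = !decide (Even ((ofLex x).1 : ℕ)) := by
    intro x y h
    rw [← decide_not, decide_eq_decide]
    exact h
  refine ⟨_, ⟨M, hM.planar_of_hasArches hq hN ha ⟨hf.1, hf.2.2⟩ ⟨hg.1, hg.2.2⟩,
    hM.regular hq hN, hM.card_vertex hq hN, black, ⟨fun d => ?_, fun d => ?_⟩, gridCycle q L,
    hM.isHamiltonianCycle hq hN, hM.isRigid hq hN, L 0 0, ⟨0, Or.inl rfl⟩, ?_⟩, ?_⟩
  · obtain ⟨i, k, -, -, rfl⟩ := hL.surj d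
    rw [hM.rot_eq, hblack, hblack]
  · rcases hL.dart_cases d with ⟨i, -, rfl⟩ | ⟨i, -, rfl⟩ | ⟨x, rfl⟩ | ⟨x, rfl⟩
    · rw [hM.opp_eq, hblack, hblack, ← decide_not, decide_eq_decide, Nat.even_add_one]
    · obtain ⟨j, hj⟩ : ∃ j, L i q = L (j + 1) q := ⟨i + 2 * N - 1, by
        rw [Nat.sub_add_cancel (by omega), hL.vperiod]⟩
      rw [hj, hM.opp_eq', hblack, hblack, ← decide_not, decide_eq_decide, Nat.even_add_one, not_not]
    · rw [ha.left, leftDart, leftDart, hblack, hblack]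
      exact hcol _ _ (hf.2.1 x)
    · rw [ha.right, rightDart, rightDart, hblack, hblack]
      exact hcol _ _ (hg.2.1 x)
  · rw [hblack]
    simp
  · rw [RigidConfig.grid]
    simp only
    rw [hM.grid_eq]
    exact ha

/-! ### The bijection with pairs of arch systems, and the main theorem -/

/-- The two sides of a rigid Hamiltonian cycle decouple. -/
theorem rigidCount_eq (q N : ℕ) (hq : 0 < q) (hN : 0 < N) :
    rigidCount q N = archCount q N ^ 2 := by
  have hex (A : Σ n : ℕ, RigidConfig q N (Fin n)) :
      ∃ fg : {f : HalfArch q N → HalfArch q N // IsArchSystem f} ×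
        {f : HalfArch q N → HalfArch q N // IsArchSystem f},
        HasArches A.2.map A.2.grid fg.1.1 fg.2.1 := by
    obtain ⟨f, g, h, hf, hg⟩ := A.2.exists_archSystems hq hN
    exact ⟨(⟨f, hf⟩, ⟨g, hg⟩), h⟩
  choose T hT using hex
  -- The pair of arch systems is a complete invariant: isomorphisms preserve the numbering by the
  -- marked dart, and the arches determine the rest of the map.
  have hiso (A B : Σ n : ℕ, RigidConfig q N (Fin n)) : A.2.Iso B.2 ↔ T A = T B := by
    constructor
    · intro h
      obtain ⟨h1, h2⟩ := B.2.hasArches_unique hq (RigidConfig.Iso.hasArches h (hT A)) (hT B)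
      exact Prod.ext (Subtype.ext h1) (Subtype.ext h2)
    · intro h
      have hB := hT B
      rw [← h] at hB
      exact A.2.iso_of_hasArches B.2 hq hN (hT A) hB
  let Φ : Quotient (rigidSetoid q N) → _ := Quotient.lift T fun A B h => (hiso A B).1 h
  have hΦ : Function.Bijective Φ := by
    constructor
    · intro c d h
      induction c using Quotient.inductionOn with | _ A => ?_
      induction d using Quotient.inductionOn with | _ B => ?_
      exact Quotient.sound ((hiso A B).2 h)
    · rintro ⟨⟨f, hf⟩, ⟨g, hg⟩⟩
      obtain ⟨n, A, hA⟩ := exists_rigidConfig hq hN hf hg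
      refine ⟨Quotient.mk _ ⟨n, A⟩, ?_⟩
      obtain ⟨h1, h2⟩ := A.hasArches_unique hq (hT ⟨n, A⟩) hA
      exact Prod.ext (Subtype.ext h1) (Subtype.ext h2)
  rw [rigidCount, Nat.card_congr (Equiv.ofBijective Φ hΦ), Nat.card_prod, archCount, sq]

theorem mainTheorem2 (q : ℕ) (hq : 2 ≤ q) :
    -- decoupling of the two sides of the cycle
    (∀ N : ℕ, 1 ≤ N → rigidCount q N = archCount q N ^ 2) ∧
    -- the recursion for arch systems, and its form for the generating function
    archCount q 0 = 1 ∧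
    (∀ N : ℕ, 1 ≤ N → archCount q N =
      ∑ m ∈ Finset.Nat.antidiagonalTuple q (N - 1), ∏ j, archCount q (m j)) ∧
    (PowerSeries.mk (archCount q) = 1 + PowerSeries.X * PowerSeries.mk (archCount q) ^ q) ∧
    -- the Fuss-Catalan numbers
    (∀ N : ℕ, (archCount q N : ℝ) =
      1 / (((q : ℝ) - 1) * N + 1) * ((q * N).choose N : ℝ)) ∧
    (∀ N : ℕ, 1 ≤ N → (rigidCount q N : ℝ) =
      (1 / (((q : ℝ) - 1) * N + 1) * ((q * N).choose N : ℝ)) ^ 2) ∧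
    -- the asymptotics
    ((fun N : ℕ => (rigidCount q N : ℝ)) ~[atTop] fun N : ℕ =>
      (q : ℝ) / (2 * Real.pi * ((q : ℝ) - 1) ^ 3) *
        ((q : ℝ) ^ q / ((q : ℝ) - 1) ^ (q - 1)) ^ (2 * N) / (N : ℝ) ^ 3) ∧
    -- the configuration exponent is `-1`, for one and only one choice of the three constants
    (∀ ϰ μ γ : ℝ, HasConfigurationAsymptotics (rigidCount q) ϰ μ γ ↔
      ϰ = (q : ℝ) / (2 * Real.pi * ((q : ℝ) - 1) ^ 3) ∧
      μ = (q : ℝ) ^ q / ((q : ℝ) - 1) ^ (q - 1) ∧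
      γ = -1) := by
  have hsq : ∀ N : ℕ, 1 ≤ N → rigidCount q N = archCount q N ^ 2 := fun N hN =>
    rigidCount_eq q N (by omega) hN
  have hgen := mk_archCount_eq q hq
  have hgenR : PowerSeries.mk (fun N => (archCount q N : ℝ)) =
      1 + PowerSeries.X * PowerSeries.mk (fun N => (archCount q N : ℝ)) ^ q := by
    have h1 : PowerSeries.map (Nat.castRingHom ℝ) (PowerSeries.mk (archCount q)) =
        PowerSeries.mk (fun N => (archCount q N : ℝ)) := by
      ext N; simp
    have h := congrArg (PowerSeries.map (Nat.castRingHom ℝ)) hgen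
    rw [map_add, map_mul, map_pow, map_one, PowerSeries.map_X, h1] at h
    exact h
  have hfc : ∀ N : ℕ, (archCount q N : ℝ) =
      1 / (((q : ℝ) - 1) * N + 1) * ((q * N).choose N : ℝ) := fun N => by
    rw [← coeff_eq_fussCatalan q (by omega) _ hgenR N, PowerSeries.coeff_mk]
  have hz : ∀ N : ℕ, 1 ≤ N → (rigidCount q N : ℝ) =
      (1 / (((q : ℝ) - 1) * N + 1) * ((q * N).choose N : ℝ)) ^ 2 := fun N hN => by
    rw [hsq N hN, Nat.cast_pow, hfc]
  have hasym := (fussCatalan_sq_isEquivalent q hq).congr_left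
    ((eventually_ge_atTop 1).mono fun N hN => (hz N hN).symm)
  have hq1 : (0 : ℝ) < (q : ℝ) - 1 := by
    have : (2 : ℝ) ≤ q := by exact_mod_cast hq
    linarith
  have hq0 : (0 : ℝ) < q := by linarith
  have hpi := Real.pi_pos
  refine ⟨hsq, ?_, fun N hN => ?_, hgen, hfc, hz, hasym, ?_⟩
  · have := hfc 0
    simp only [Nat.cast_zero, mul_zero, zero_add, Nat.choose_self, Nat.cast_one, div_one,
      mul_one] at this
    exact_mod_cast this
  · obtain ⟨n, rfl⟩ : ∃ n, N = n + 1 := ⟨N - 1, by omega⟩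
    have h := congrArg (PowerSeries.coeff (n + 1)) hgen
    rw [map_add, PowerSeries.coeff_succ_X_mul, PowerSeries.coeff_mk, PowerSeries.coeff_one,
      if_neg (by omega), zero_add, coeff_pow_eq_sum_antidiagonalTuple] at h
    rw [Nat.add_sub_cancel]
    exact h
  · exact hasConfigurationAsymptotics_iff (by positivity) (by positivity) hasym
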